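/- Let $r\ge 1$ be an integer and $d=2r$. In the rank-$r$ Haar-measure encryption of a bit, $\mathtt Q_r$, the key is a Haar-random unitary $U\in\mathcal U(d)$ and the ciphertext of $b\in\{0,1\}$ is the state $U\sigma_bU^*$ on $\mathbb C^d$, where $\sigma_b=\frac1r\sum_{j=rb}^{r(b+1)-1}|j\rangle\langle j|$. A telegraphing attack $\mathtt A$ on $\mathtt Q_r$ consists of a measurement channel $\Phi(\rho)=\sum_{x\in X}\mathrm{Tr}(P_x\rho)\,|x\rangle\langle x|$, given by a POVM $\{P_x\}_{x\in X}$ on $\mathbb C^d$ with $X$ finite, and, for each key $U$, a two-outcome POVM $\{P^U_0,P^U_1\}$ on $\mathbb C^X$; its winning probability is $$\mathfrak c(\mathtt Q_r|\mathtt A)=\int_{\mathcal U(d)}\tfrac12\sum_{b=0}^1\mathrm{Tr}\big[P^U_b\,\Phi(U\sigma_bU^*)\big]\,dU ,$$ and the (one-copy) telegraphing-distinguishing value $\mathfrak c(\mathtt Q_r|\mathscr M)$ is the supremum of this quantity over all telegraphing attacks. Let $\mathtt A_r$ be the attack in which $\Phi(\rho)=\sum_{i=0}^{d-1}|i\rangle\langle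 i|\rho|i\rangle\langle i|$ is the measurement in the computational basis and $P^U_b=\sum_{i\in G_{b,U}}|i\rangle\langle i|$, where $G_{0,U}=\{i:\langle i|U\sigma_0U^*|i\rangle\ge\langle i|U\sigma_1U^*|i\rangle\}$ and $G_{1,U}$ is its complement. Then $\mathtt A_r$ is a telegraphing attack, and the following hold. 1. For every $r\ge1$, $$\mathfrak c(\mathtt Q_r|\mathtt A_r)=\frac12+\frac1{2^{d+1}}\binom{d}{d/2}.$$ 2. There is a constant $C$ such that for every $r\ge 1$, $$\left|\mathfrak c(\mathtt Q_r|\mathtt A_r)-\frac12-\frac1{\sqrt{2\pi d}}\right|\le\frac{C}{d^{3/2}},$$ that is, $\mathfrak c(\mathtt Q_r|\mathtt A_r)=\frac12+\frac1{\sqrt{2\pi d}}+O(d^{-3/2})$. 3. The one-copy upper bound on the telegraphing-distinguishing value is tight in order: for every $r\ge1$, $$\mathfrak c(\mathtt Q_r|\mathtt A_r)\le\mathfrak c(\mathtt Q_r|\mathscr M)\le\frac12+\frac1{2\sqrt{d+1}},$$ and there is a constant $c>0$ such that $\mathfrak c(\mathtt Q_r|\mathscr M)\ge\frac12+c\cdot\frac{1}{2\sqrt{d+1}}$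 for every $r\ge1$. -/

import Mathlib

open MeasureTheory Matrix
open scoped ComplexOrder

/-! Finite-dimensional Hilbert spaces are `ℂ^A` for a finite register `A`, so operators are complex
matrices indexed by the register. -/

/-- A quantum state (density operator) on `ℂ^H`. -/
structure IsQuantumState {H : Type*} [Fintype H] (ρ : Matrix H H ℂ) : Prop where
  posSemidef : ρ.PosSemidef
  trace_eq_one : ρ.trace = 1

/-- The finite family `P m`, `m ∈ S`, of operators on `ℂ^B` is a POVM. -/
structure IsPOVM {M B : Type*} [Fintype B] [DecidableEq B]
    (S : Finset M) (P : M → Matrix B B ℂ) : Prop where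
  posSemidef : ∀ m ∈ S, (P m).PosSemidef
  sum_eq_one : ∑ m ∈ S, P m = 1

/-- The map `Φ ⊗ id_k` on `𝓑(ℂ^H ⊗ ℂ^k)`: `Φ` applied to each block of a `k × k` block matrix. -/
def tensorId {H B : Type*} (Φ : Matrix H H ℂ →ₗ[ℂ] Matrix B B ℂ) (k : ℕ)
    (X : Matrix (H × Fin k) (H × Fin k) ℂ) : Matrix (B × Fin k) (B × Fin k) ℂ :=
  Matrix.of fun p q => Φ (Matrix.of fun h h' => X (h, p.2) (h', q.2)) p.1 q.1

/-- A quantum channel: a completely positive trace-preserving linear map. -/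
structure IsQuantumChannel {H B : Type*} [Fintype H] [Fintype B]
    (Φ : Matrix H H ℂ →ₗ[ℂ] Matrix B B ℂ) : Prop where
  completelyPositive : ∀ (k : ℕ) (X : Matrix (H × Fin k) (H × Fin k) ℂ),
    X.PosSemidef → (tensorId Φ k X).PosSemidef
  tracePreserving : ∀ ρ : Matrix H H ℂ, (Φ ρ).trace = ρ.trace

/-- A measurement (quantum-to-classical) channel: for some POVM `{P_x}` with outcomes in the output
register, `Φ(ρ) = ∑ₓ Tr(P_x ρ) |x⟩⟨x|`. -/
def IsMeasurementChannel {H B : Type*} [Fintype H] [DecidableEq H] [Fintype B] [DecidableEq B]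
    (Φ : Matrix H H ℂ →ₗ[ℂ] Matrix B B ℂ) : Prop :=
  ∃ P : B → Matrix H H ℂ, IsPOVM Finset.univ P ∧
    ∀ ρ, Φ ρ = ∑ x, (P x * ρ).trace • Matrix.single x x (1 : ℂ)

/-- A quantum encryption of classical messages, with message set `M`, key space `K` and
codespace `ℂ^H`. -/
structure QECM (M K H : Type*) [Fintype M] [MeasurableSpace K] [Fintype H] where
  /-- the key distribution -/
  keyDist : Measure K
  isProbabilityMeasure : IsProbabilityMeasure keyDist
  /-- the ciphertexts `σ^k_m` -/
  cipher : K → M → Matrix H H ℂ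
  isQuantumState : ∀ k m, IsQuantumState (cipher k m)
  measurable_cipher : ∀ m i j, Measurable fun k => cipher k m i j

/-- A one-copy, one-receiver attack `(M₀, ℂ^B, {P^k_m}, Φ)` against a QECM: `Φ` is applied to the
ciphertext, then the receiver learns the key `k` and measures `{P^k_m}` to guess `m ∈ M₀`. -/
structure Attack (M K H B : Type*) [MeasurableSpace K] [Fintype H] [Fintype B]
    [DecidableEq B] where
  /-- the set of messages used in the game -/
  messages : Finset M
  /-- the receiver's POVM for each key -/
  povm : K → M → Matrix B B ℂ
  isPOVM : ∀ k, IsPOVM messages (povm k)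
  measurable_povm : ∀ m ∈ messages, ∀ i j, Measurable fun k => povm k m i j
  /-- the channel applied to the ciphertext -/
  channel : Matrix H H ℂ →ₗ[ℂ] Matrix B B ℂ
  isQuantumChannel : IsQuantumChannel channel

/-- The winning probability
`∫ (1/N) ∑_{m ∈ M₀} Tr(P^k_m Φ(σ^k_m)) dπ(k)`, where `N = |M₀|`.
(The trace is a real number; `re` only changes its type.) -/
noncomputable def winProb {M K H B : Type*} [Fintype M] [MeasurableSpace K] [Fintype H]
    [Fintype B] [DecidableEq B] (Q : QECM M K H) (A : Attack M K H B) : ℝ :=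
  ∫ k, (1 / (A.messages.card : ℝ)) *
    ∑ m ∈ A.messages, ((A.povm k m * A.channel (Q.cipher k m)).trace).re ∂Q.keyDist

/-- The one-copy `N`-message telegraphing value: the supremum of the winning probabilities of all
attacks on `N` messages whose channel is a measurement channel. For `N = 2` this is the
telegraphing-distinguishing value. -/
noncomputable def telegraphingValue {M K H : Type*} [Fintype M] [MeasurableSpace K] [Fintype H]
    [DecidableEq H] (N : ℕ) (Q : QECM M K H) : ℝ :=
  sSup {p : ℝ | ∃ (B : Type) (_ : Fintype B) (_ : DecidableEq B) (A : Attack M K H B),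
    A.messages.card = N ∧ IsMeasurementChannel A.channel ∧ p = winProb Q A}

/-! ### The Haar measure on the unitary group -/

noncomputable instance unitaryGroupMeasurableSpace (d : ℕ) : MeasurableSpace (unitaryGroup (Fin d) ℂ) := borel _

instance unitaryGroupBorelSpace (d : ℕ) : BorelSpace (unitaryGroup (Fin d) ℂ) := ⟨rfl⟩

instance unitaryGroupCompactSpace (d : ℕ) : CompactSpace (unitaryGroup (Fin d) ℂ) := by
  have hc : IsCompact (Set.pi Set.univ fun _ : Fin d => Set.pi Set.univ fun _ : Fin d =>
      Metric.closedBall (0 : ℂ) 1) :=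
    isCompact_univ_pi fun _ => isCompact_univ_pi fun _ => isCompact_closedBall _ _
  have hcl : IsClosed (unitaryGroup (Fin d) ℂ : Set (Matrix (Fin d) (Fin d) ℂ)) := by
    have : (unitaryGroup (Fin d) ℂ : Set (Matrix (Fin d) (Fin d) ℂ)) =
        {U | U * star U = 1} := by
      ext U
      exact mem_unitaryGroup_iff
    rw [this]
    exact isClosed_eq (continuous_id.mul continuous_star) continuous_const
  refine isCompact_iff_compactSpace.mp (hc.of_isClosed_subset hcl ?_)
  intro U hU i _ j _
  simpa using entry_norm_bound_of_unitary hU i j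

/-- The Haar probability measure on `U(d)`. -/
noncomputable def haarUnitary (d : ℕ) : Measure (unitaryGroup (Fin d) ℂ) :=
  Measure.haarMeasure ⊤

instance haarUnitaryIsProbabilityMeasure (d : ℕ) : IsProbabilityMeasure (haarUnitary d) :=
  ⟨Measure.haarMeasure_self (K₀ := ⊤)⟩

/-! ### Haar-measure encryption -/

/-- `σ_i = (1/r) ∑_{j = ri}^{r(i+1)-1} |j⟩⟨j|` on `ℂ^{rn}`. -/
noncomputable def blockState (n r : ℕ) (i : Fin n) : Matrix (Fin (r * n)) (Fin (r * n)) ℂ :=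
  (1 / (r : ℂ)) • ∑ j ∈ Finset.univ.filter (fun j : Fin (r * n) =>
    r * (i : ℕ) ≤ (j : ℕ) ∧ (j : ℕ) < r * ((i : ℕ) + 1)), Matrix.single j j (1 : ℂ)

theorem blockState_isQuantumState (n r : ℕ) [NeZero r] (i : Fin n) :
    IsQuantumState (blockState n r i) := by
  constructor
  · unfold blockState
    refine PosSemidef.smul (posSemidef_sum (R := ℂ) _ fun j _ => ?_) ?_
    · rw [← Matrix.diagonal_single]
      refine PosSemidef.diagonal fun k => ?_
      by_cases h : k = j
      · subst h; simp
      · simp [h]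
    · have : (0 : ℝ) ≤ 1 / r := by positivity
      have h : (0 : ℂ) ≤ ((1 / r : ℝ) : ℂ) := by exact_mod_cast this
      simpa using h
  · have hcard : (Finset.univ.filter fun j : Fin (r * n) =>
        r * (i : ℕ) ≤ (j : ℕ) ∧ (j : ℕ) < r * (i + 1)).card = r := by
      have hle : r * ((i : ℕ) + 1) ≤ r * n := Nat.mul_le_mul_left _ i.2
      rw [← Finset.card_map Fin.valEmbedding]
      have : (Finset.univ.filter fun j : Fin (r * n) =>
          r * (i : ℕ) ≤ (j : ℕ) ∧ (j : ℕ) < r * (i + 1)).map Fin.valEmbedding =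
          Finset.Ico (r * (i : ℕ)) (r * (i + 1)) := by
        ext x
        simp only [Finset.mem_map, Finset.mem_filter, Finset.mem_univ, true_and,
          Fin.valEmbedding_apply, Finset.mem_Ico]
        constructor
        · rintro ⟨j, hj, rfl⟩
          exact hj
        · intro hx
          exact ⟨⟨x, lt_of_lt_of_le hx.2 hle⟩, hx, rfl⟩
      rw [this, Nat.card_Ico, Nat.mul_add, mul_one, Nat.add_sub_cancel_left]
    have hr : (r : ℂ) ≠ 0 := by exact_mod_cast NeZero.ne r
    unfold blockState
    rw [trace_smul, trace_sum]
    simp [hcard, hr]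

/-- The rank-`r` Haar-measure encryption of `n` messages: the key is a Haar-random
`U ∈ U(rn)` and the ciphertext of `i` is `U σ_i U*`. -/
noncomputable def haarEncryption (n r : ℕ) [NeZero r] :
    QECM (Fin n) (unitaryGroup (Fin (r * n)) ℂ) (Fin (r * n)) where
  keyDist := haarUnitary (r * n)
  isProbabilityMeasure := inferInstance
  cipher U i := (U : Matrix (Fin (r * n)) (Fin (r * n)) ℂ) * blockState n r i *
    (U : Matrix (Fin (r * n)) (Fin (r * n)) ℂ)ᴴ
  isQuantumState U i := by
    refine ⟨(blockState_isQuantumState n r i).posSemidef.mul_mul_conjTranspose_same _, ?_⟩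
    have hU : (U : Matrix (Fin (r * n)) (Fin (r * n)) ℂ)ᴴ *
        (U : Matrix (Fin (r * n)) (Fin (r * n)) ℂ) = 1 := mem_unitaryGroup_iff'.mp U.2
    rw [trace_mul_comm, ← mul_assoc, hU, one_mul]
    exact (blockState_isQuantumState n r i).trace_eq_one
  measurable_cipher m i j := by
    refine Continuous.measurable ?_
    have h : Continuous fun U : unitaryGroup (Fin (r * n)) ℂ =>
        (U : Matrix (Fin (r * n)) (Fin (r * n)) ℂ) * blockState n r m *
          (U : Matrix (Fin (r * n)) (Fin (r * n)) ℂ)ᴴ :=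
      (continuous_subtype_val.matrix_mul continuous_const).matrix_mul
        continuous_subtype_val.matrix_conjTranspose
    exact h.matrix_elem i j

/-! ### The computational-basis attack on the encryption of a bit -/

/-- Measurement in the computational basis, `Φ(ρ) = ∑ᵢ |i⟩⟨i| ρ |i⟩⟨i|`. -/
noncomputable def basisMeasurement (H : Type*) [Fintype H] [DecidableEq H] :
    Matrix H H ℂ →ₗ[ℂ] Matrix H H ℂ where
  toFun ρ := ∑ i, Matrix.single i i (1 : ℂ) * ρ * Matrix.single i i (1 : ℂ)
  map_add' ρ ρ' := by simp only [mul_add, add_mul, Finset.sum_add_distrib]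
  map_smul' c ρ := by
    simp only [Matrix.mul_smul, Matrix.smul_mul, Finset.smul_sum, RingHom.id_apply]

theorem basisMeasurement_eq_diagonal {H : Type*} [Fintype H] [DecidableEq H] (ρ : Matrix H H ℂ) :
    basisMeasurement H ρ = Matrix.diagonal fun i => ρ i i := by
  ext a b
  simp only [basisMeasurement, LinearMap.coe_mk, AddHom.coe_mk, Matrix.sum_apply,
    Matrix.diagonal_apply]
  simp [Matrix.single_mul_mul_single, Matrix.single_apply]
  split_ifs with h
  · subst h
    simp
  · exact Finset.sum_eq_zero fun x _ => if_neg fun h' => h (h'.1.symm.trans h'.2)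

theorem basisMeasurement_isQuantumChannel (H : Type*) [Fintype H] [DecidableEq H] :
    IsQuantumChannel (basisMeasurement H) := by
  constructor
  · intro k X hX
    have key : tensorId (basisMeasurement H) k X =
        ∑ i : H, (Matrix.diagonal fun p : H × Fin k => if p.1 = i then (1 : ℂ) else 0) * X *
          (Matrix.diagonal fun p : H × Fin k => if p.1 = i then (1 : ℂ) else 0)ᴴ := by
      ext p q
      simp only [tensorId, basisMeasurement_eq_diagonal, Matrix.of_apply, Matrix.diagonal_apply,
        Matrix.sum_apply, Matrix.diagonal_conjTranspose, Matrix.mul_diagonal,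
        Matrix.diagonal_mul, Pi.star_apply]
      by_cases h : p.1 = q.1
      · rw [Finset.sum_eq_single p.1]
        · rw [if_pos h, if_pos rfl, if_pos h.symm]
          have hq : (p.1, q.2) = q := Prod.ext h rfl
          simp [hq]
        · intro b _ hb
          simp [hb.symm]
        · simp
      · rw [if_neg h]
        symm
        refine Finset.sum_eq_zero fun i _ => ?_
        by_cases hp : p.1 = i
        · have : q.1 ≠ i := fun hq => h (hp.trans hq.symm)
          simp [this]
        · simp [hp]
    rw [key]
    exact posSemidef_sum _ fun i _ => hX.mul_mul_conjTranspose_same _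
  · intro ρ
    rw [basisMeasurement_eq_diagonal, Matrix.trace_diagonal]
    rfl

open Classical in
/-- `G_{0,U} = {i | ⟨i|Uσ₀U*|i⟩ ≥ ⟨i|Uσ₁U*|i⟩}` and `G_{1,U}` is its complement. -/
noncomputable def guessSet (r : ℕ) [NeZero r] (U : unitaryGroup (Fin (r * 2)) ℂ) (b : Fin 2) :
    Finset (Fin (r * 2)) :=
  let G₀ := Finset.univ.filter fun i =>
    ((haarEncryption 2 r).cipher U 0 i i).re ≥ ((haarEncryption 2 r).cipher U 1 i i).re
  if b = 0 then G₀ else G₀ᶜ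

/-- `P^U_b = ∑_{i ∈ G_{b,U}} |i⟩⟨i|`. -/
noncomputable def guessPOVM (r : ℕ) [NeZero r] (U : unitaryGroup (Fin (r * 2)) ℂ) (b : Fin 2) :
    Matrix (Fin (r * 2)) (Fin (r * 2)) ℂ :=
  ∑ i ∈ guessSet r U b, Matrix.single i i (1 : ℂ)

theorem guessPOVM_isPOVM (r : ℕ) [NeZero r] (U : unitaryGroup (Fin (r * 2)) ℂ) :
    IsPOVM Finset.univ (guessPOVM r U) := by
  classical
  constructor
  · intro b _
    refine posSemidef_sum _ fun j _ => ?_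
    rw [← Matrix.diagonal_single]
    refine PosSemidef.diagonal fun k => ?_
    by_cases h : k = j
    · subst h; simp
    · simp [h]
  · have h : guessSet r U 1 = (guessSet r U 0)ᶜ := by simp [guessSet]
    rw [Fin.sum_univ_two, guessPOVM, guessPOVM, h, Finset.sum_add_sum_compl]
    exact Matrix.sum_single_one

theorem guessPOVM_measurable (r : ℕ) [NeZero r] (b : Fin 2) (i j : Fin (r * 2)) :
    Measurable fun U => guessPOVM r U b i j := by
  classical
  have hS : ∀ x, MeasurableSet {U | x ∈ guessSet r U b} := by
    intro x
    have h0 : MeasurableSet {U : unitaryGroup (Fin (r * 2)) ℂ |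
        ((haarEncryption 2 r).cipher U 1 x x).re ≤ ((haarEncryption 2 r).cipher U 0 x x).re} :=
      measurableSet_le (Complex.measurable_re.comp ((haarEncryption 2 r).measurable_cipher 1 x x))
        (Complex.measurable_re.comp ((haarEncryption 2 r).measurable_cipher 0 x x))
    by_cases hb : b = 0
    · simpa [guessSet, hb] using h0
    · convert h0.compl using 1
      ext U
      simp [guessSet, hb]
  have : (fun U => guessPOVM r U b i j) = fun U =>
      ∑ x, if x ∈ guessSet r U b then Matrix.single x x (1 : ℂ) i j else 0 := by
    funext U
    rw [guessPOVM, Matrix.sum_apply, Finset.sum_ite_mem, Finset.univ_inter]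
  rw [this]
  exact Finset.measurable_sum _ fun x _ => Measurable.ite (hS x) measurable_const measurable_const

/-- The computational-basis measurement attack on the rank-`r` Haar-measure encryption of a bit. -/
noncomputable def basisAttack (r : ℕ) [NeZero r] :
    Attack (Fin 2) (unitaryGroup (Fin (r * 2)) ℂ) (Fin (r * 2)) (Fin (r * 2)) where
  messages := Finset.univ
  povm := guessPOVM r
  isPOVM := guessPOVM_isPOVM r
  measurable_povm b _ := guessPOVM_measurable r b
  channel := basisMeasurement (Fin (r * 2))
  isQuantumChannel := basisMeasurement_isQuantumChannel _

/-! ### Moments of the radial Gaussian weight -/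

/-! For a row `u` of the key, let `h` be the mass of `u` on the first `r` coordinates minus its mass
on the last `r` (`halfDiff`). Rows are unit vectors, so outcome `i` has probability `(1 ± h) / (2r)`
under the two messages (`cipher_diag_re`). Guessing the likelier message turns `±h` into `|h|`, and
the basis attack wins with probability `1/2 + E|h| / 2`.

A row of a Haar unitary is uniform on the sphere of `ℂ^(2r)`. Since `|h|` is homogeneous of degree
two, its mean on the sphere is the ratio of the Gaussian integrals of `|‖x₀‖² - ‖x₁‖²|` and `‖x₀‖² +
‖x₁‖²` over `ℂ^r × ℂ^r` (`integral_gaussian_halfDiff`). Polar coordinates in each factor leave a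
double integral in two radii, computed by integration by parts
(`integral_abs_sq_sub_mul_radialWeight`). The result is `E|h| = C(2r, r) / 4^r`
(`integral_abs_halfDiff`).

No measurement does better. Diagonalising each POVM element splits it into weighted rank-one tests;
by Haar invariance each test is worth as much as a basis vector, and the weights sum to `Tr 1 = 2r`.
The telegraphing value is therefore exactly that of the basis attack
(`telegraphingValue_haarEncryption`), and all the bounds reduce to estimates of `C(2r, r) / 4^r`,
which come from the Wallis product. -/

theorem integrableOn_pow_mul_exp_neg_sq {b : ℝ} (hb : 0 < b) (n : ℕ) :
    IntegrableOn (fun s : ℝ => s ^ n * Real.exp (-b * s ^ 2)) (Set.Ioi 0) := by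
  have h := integrableOn_rpow_mul_exp_neg_mul_sq hb (s := (n : ℝ))
    (by have : (0 : ℝ) ≤ n := n.cast_nonneg
        linarith)
  simpa only [Real.rpow_natCast] using h

/-- The substitution `u = b s²` gives `Γ(n + 1)`; only odd powers occur because the spaces have even
real dimension. -/
theorem integral_odd_pow_mul_exp_neg_sq {b : ℝ} (hb : 0 < b) (n : ℕ) :
    ∫ s in Set.Ioi (0 : ℝ), s ^ (2 * n + 1) * Real.exp (-b * s ^ 2) =
      (n.factorial : ℝ) / (2 * b ^ (n + 1)) := by
  have h := integral_rpow_mul_exp_neg_mul_rpow (p := 2) (q := ((2 * n + 1 : ℕ) : ℝ)) (b := b)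
    two_pos (by have : (0 : ℝ) ≤ ((2 * n + 1 : ℕ) : ℝ) := Nat.cast_nonneg _
                linarith) hb
  simp only [Real.rpow_natCast, Real.rpow_two] at h
  have e1 : (((2 * n + 1 : ℕ) : ℝ) + 1) / 2 = (n : ℝ) + 1 := by push_cast; ring
  have e2 : -(((2 * n + 1 : ℕ) : ℝ) + 1) / 2 = -((n + 1 : ℕ) : ℝ) := by push_cast; ring
  rw [h, e1, e2, Real.Gamma_nat_eq_factorial, Real.rpow_neg hb.le, Real.rpow_natCast]
  field_simp

/-- The radial weight `s ^ (2m+1) exp (-s²)` of the Gaussian on `ℂ^(m+1)`. -/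
noncomputable def radialWeight (m : ℕ) (s : ℝ) : ℝ := s ^ (2 * m + 1) * Real.exp (-s ^ 2)

theorem continuous_radialWeight (m : ℕ) : Continuous (radialWeight m) := by
  unfold radialWeight
  fun_prop

theorem integrable_pow_mul_radialWeight (m k : ℕ) :
    Integrable (fun s => s ^ k * radialWeight m s) (volume.restrict (Set.Ioi 0)) := by
  have h := integrableOn_pow_mul_exp_neg_sq one_pos (k + (2 * m + 1))
  refine (integrable_congr (Filter.Eventually.of_forall fun s => ?_)).mp h
  simp only [radialWeight, pow_add, neg_mul, one_mul]
  ring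

theorem integrable_radialWeight (m : ℕ) :
    Integrable (radialWeight m) (volume.restrict (Set.Ioi 0)) := by
  simpa using integrable_pow_mul_radialWeight m 0

theorem integral_radialWeight (m : ℕ) :
    ∫ s in Set.Ioi (0 : ℝ), radialWeight m s = (m.factorial : ℝ) / 2 := by
  have h := integral_odd_pow_mul_exp_neg_sq one_pos m
  simpa [radialWeight] using h

theorem integral_sq_mul_radialWeight (m : ℕ) :
    ∫ s in Set.Ioi (0 : ℝ), s ^ 2 * radialWeight m s = ((m + 1).factorial : ℝ) / 2 := by
  rw [← integral_radialWeight (m + 1)]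
  congr 1
  ext s
  simp only [radialWeight]
  ring

/-- This derivative trades the weight `s² w` for `(m + 1) w` plus a boundary term in the integration
by parts below. -/
theorem hasDerivAt_mul_radialWeight (m : ℕ) (s : ℝ) :
    HasDerivAt (fun s => s * radialWeight m s)
      (2 * (m + 1) * radialWeight m s - 2 * (s ^ 2 * radialWeight m s)) s := by
  have h1 : HasDerivAt (fun s : ℝ => s ^ (2 * m + 2)) (((2 * m + 2 : ℕ) : ℝ) * s ^ (2 * m + 1)) s :=
    hasDerivAt_pow (2 * m + 2) s
  have h2 : HasDerivAt (fun s : ℝ => Real.exp (-s ^ 2)) (Real.exp (-s ^ 2) * (-(2 * s))) s := by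
    have : HasDerivAt (fun s : ℝ => -s ^ 2) (-(2 * s)) s := by
      simpa using (hasDerivAt_pow 2 s).fun_neg
    exact this.exp
  have e : (fun s => s * radialWeight m s) =
      (fun s : ℝ => s ^ (2 * m + 2)) * fun s : ℝ => Real.exp (-s ^ 2) := by
    funext x
    simp only [radialWeight, Pi.mul_apply]
    ring
  rw [e]
  refine (h1.mul h2).congr_deriv ?_
  simp only [radialWeight]
  push_cast
  ring

theorem tendsto_mul_radialWeight (m : ℕ) :
    Filter.Tendsto (fun s => s * radialWeight m s) Filter.atTop (nhds 0) := by
  have h := (Real.tendsto_pow_mul_exp_neg_atTop_nhds_zero (m + 1)).comp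
    (Filter.tendsto_pow_atTop (α := ℝ) two_ne_zero)
  refine h.congr fun s => ?_
  simp only [Function.comp, radialWeight]
  ring

/-! ### The mean absolute difference of two independent squared radii -/

theorem measurable_real_sign : Measurable Real.sign := by
  unfold Real.sign
  exact Measurable.ite measurableSet_Iio measurable_const
    (Measurable.ite measurableSet_Ioi measurable_const measurable_const)

theorem abs_real_sign_le (x : ℝ) : |Real.sign x| ≤ 1 := by
  rcases Real.sign_apply_eq x with h | h | h <;> simp [h]

theorem integrable_sign_mul {f : ℝ × ℝ → ℝ} {μ : Measure (ℝ × ℝ)} (hf : Integrable f μ) :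
    Integrable (fun z => Real.sign (z.1 - z.2) * f z) μ :=
  hf.bdd_mul (c := 1)
    (measurable_real_sign.comp (measurable_fst.sub measurable_snd)).aestronglyMeasurable
    (Filter.Eventually.of_forall fun _ => abs_real_sign_le _)

theorem integrable_sign_sub_mul {f : ℝ → ℝ} {μ : Measure ℝ} (hf : Integrable f μ) (t : ℝ) :
    Integrable (fun s => Real.sign (s - t) * f s) μ :=
  hf.bdd_mul (c := 1)
    (measurable_real_sign.comp (measurable_id.sub measurable_const)).aestronglyMeasurable
    (Filter.Eventually.of_forall fun _ => abs_real_sign_le _)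

/-- Integration by parts against a sign function, whose derivative is twice a point mass at `t`:
each side of `t` contributes `-g t`, as `g` vanishes at `0` and at infinity. -/
theorem integral_sign_mul_deriv {g g' : ℝ → ℝ} (hg : ∀ s, HasDerivAt g (g' s) s)
    (hg' : IntegrableOn g' (Set.Ioi 0)) (h0 : g 0 = 0)
    (hlim : Filter.Tendsto g Filter.atTop (nhds 0)) {t : ℝ} (ht : 0 < t) :
    ∫ s in Set.Ioi (0 : ℝ), Real.sign (s - t) * g' s = -2 * g t := by
  have hint : IntegrableOn (fun s => Real.sign (s - t) * g' s) (Set.Ioi 0) :=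
    integrable_sign_sub_mul hg' t
  have hright : ∫ s in Set.Ioi t, Real.sign (s - t) * g' s = -g t := by
    rw [setIntegral_congr_fun (g := g') measurableSet_Ioi]
    · rw [integral_Ioi_of_hasDerivAt_of_tendsto (hg t).continuousAt.continuousWithinAt
        (fun x _ => hg x) (hg'.mono_set (Set.Ioi_subset_Ioi ht.le)) hlim, zero_sub]
    · intro s hs
      simp [Real.sign_of_pos (sub_pos.mpr hs)]
  have hleft : ∫ s in Set.Ioc 0 t, Real.sign (s - t) * g' s = -g t := by
    rw [integral_Ioc_eq_integral_Ioo, setIntegral_congr_fun (g := fun s => -g' s) measurableSet_Ioo]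
    · rw [integral_neg, ← integral_Ioc_eq_integral_Ioo, ← intervalIntegral.integral_of_le ht.le,
        intervalIntegral.integral_eq_sub_of_hasDerivAt (fun x _ => hg x), h0, sub_zero]
      exact (intervalIntegrable_iff_integrableOn_Ioc_of_le ht.le).mpr
        (hg'.mono_set Set.Ioc_subset_Ioi_self)
    · intro s hs
      simp [Real.sign_of_neg (sub_neg.mpr hs.2)]
  rw [← Set.Ioc_union_Ioi_eq_Ioi ht.le, setIntegral_union (Set.Ioc_disjoint_Ioi le_rfl)
    measurableSet_Ioi (hint.mono_set Set.Ioc_subset_Ioi_self)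
    (hint.mono_set (Set.Ioi_subset_Ioi ht.le)), hleft, hright]
  ring

theorem integral_sign_mul_sq_mul_radialWeight (m : ℕ) {t : ℝ} (ht : 0 < t) :
    ∫ s in Set.Ioi (0 : ℝ), Real.sign (s - t) * (s ^ 2 * radialWeight m s) =
      (m + 1) * (∫ s in Set.Ioi (0 : ℝ), Real.sign (s - t) * radialWeight m s) +
        t * radialWeight m t := by
  have hi1 := integrable_radialWeight m
  have hi2 := integrable_pow_mul_radialWeight m 2
  have h := integral_sign_mul_deriv (hasDerivAt_mul_radialWeight m)
    ((hi1.const_mul (2 * (m + 1))).sub (hi2.const_mul 2)) (by simp)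
    (tendsto_mul_radialWeight m) ht
  have e : ∫ s in Set.Ioi (0 : ℝ), Real.sign (s - t) *
      (2 * (m + 1) * radialWeight m s - 2 * (s ^ 2 * radialWeight m s)) =
      2 * (m + 1) * (∫ s in Set.Ioi (0 : ℝ), Real.sign (s - t) * radialWeight m s) -
      2 * ∫ s in Set.Ioi (0 : ℝ), Real.sign (s - t) * (s ^ 2 * radialWeight m s) := by
    rw [← integral_const_mul, ← integral_const_mul, ← integral_sub
      ((integrable_sign_sub_mul hi1 t).const_mul _) ((integrable_sign_sub_mul hi2 t).const_mul _)]
    congr 1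
    ext s
    ring
  linarith

/-- Swapping the factors preserves `μ.prod μ`, so the integral equals its own negative. -/
theorem integral_antisymm_prod {α : Type*} [MeasurableSpace α] (μ : Measure α) [SFinite μ]
    (f : α × α → ℝ) (hf : ∀ z, f z.swap = -f z) : ∫ z, f z ∂(μ.prod μ) = 0 := by
  have h := integral_prod_swap (μ := μ) (ν := μ) f
  simp only [hf, integral_neg] at h
  linarith

theorem integrable_abs_sq_sub_mul_radialWeight (m : ℕ) :
    Integrable (fun z : ℝ × ℝ => |z.1 ^ 2 - z.2 ^ 2| * (radialWeight m z.1 * radialWeight m z.2))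
      ((volume.restrict (Set.Ioi 0)).prod (volume.restrict (Set.Ioi 0))) := by
  have hi1 := integrable_radialWeight m
  have hi2 := integrable_pow_mul_radialWeight m 2
  have h1 := (hi2.mul_prod hi1).abs.add (hi1.mul_prod hi2).abs
  have hc := continuous_radialWeight m
  refine h1.mono' (by fun_prop) (Filter.Eventually.of_forall fun z => ?_)
  simp only [Pi.add_apply, Real.norm_eq_abs]
  refine le_trans (le_of_eq ?_) (abs_sub _ _)
  rw [abs_mul, abs_abs, ← abs_mul]
  congr 1
  ring

/-- With `|s² - t²| = sign(s - t)(s² - t²)`, antisymmetry reduces the integral to twice that of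
`sign(s - t) s² w(s) w(t)`. Integrating by parts in `s` gives a multiple of `sign(s - t) w(s) w(t)`,
which integrates to zero, plus `t w(t)²`. -/
theorem integral_abs_sq_sub_mul_radialWeight (m : ℕ) :
    ∫ z : ℝ × ℝ, |z.1 ^ 2 - z.2 ^ 2| * (radialWeight m z.1 * radialWeight m z.2)
      ∂((volume.restrict (Set.Ioi 0)).prod (volume.restrict (Set.Ioi 0))) =
      ((2 * m + 1).factorial : ℝ) / 4 ^ (m + 1) := by
  set ν : Measure ℝ := volume.restrict (Set.Ioi 0) with hν
  set w := radialWeight m with hw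
  have hi1 : Integrable w ν := integrable_radialWeight m
  have hi2 : Integrable (fun s => s ^ 2 * w s) ν := integrable_pow_mul_radialWeight m 2
  have hA : Integrable (fun z : ℝ × ℝ => Real.sign (z.1 - z.2) * (z.1 ^ 2 * w z.1 * w z.2))
      (ν.prod ν) := integrable_sign_mul (hi2.mul_prod hi1)
  have hB : Integrable (fun z : ℝ × ℝ => Real.sign (z.1 - z.2) * (w z.1 * (z.2 ^ 2 * w z.2)))
      (ν.prod ν) := integrable_sign_mul (hi1.mul_prod hi2)
  have hC : Integrable (fun z : ℝ × ℝ => Real.sign (z.1 - z.2) * (w z.1 * w z.2))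
      (ν.prod ν) := integrable_sign_mul (hi1.mul_prod hi1)
  -- Positivity of the radii makes `s² - t²` and `s - t` have the same sign.
  have hpos : ∀ᵐ z : ℝ × ℝ ∂(ν.prod ν), 0 < z.1 ∧ 0 < z.2 := by
    rw [hν, Measure.prod_restrict]
    exact ae_restrict_mem (measurableSet_Ioi.prod measurableSet_Ioi)
  have e1 : ∫ z : ℝ × ℝ, |z.1 ^ 2 - z.2 ^ 2| * (w z.1 * w z.2) ∂(ν.prod ν) =
      (∫ z : ℝ × ℝ, Real.sign (z.1 - z.2) * (z.1 ^ 2 * w z.1 * w z.2) ∂(ν.prod ν)) -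
      ∫ z : ℝ × ℝ, Real.sign (z.1 - z.2) * (w z.1 * (z.2 ^ 2 * w z.2)) ∂(ν.prod ν) := by
    rw [← integral_sub hA hB]
    refine integral_congr_ae ?_
    filter_upwards [hpos] with z hz
    have hs : |z.1 ^ 2 - z.2 ^ 2| = Real.sign (z.1 - z.2) * (z.1 ^ 2 - z.2 ^ 2) := by
      rcases lt_trichotomy z.1 z.2 with h | h | h
      · rw [Real.sign_of_neg (sub_neg.mpr h), abs_of_neg (by nlinarith)]
        ring
      · simp [h]
      · rw [Real.sign_of_pos (sub_pos.mpr h), abs_of_pos (by nlinarith)]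
        ring
    rw [hs]
    ring
  have e2 : (∫ z : ℝ × ℝ, Real.sign (z.1 - z.2) * (z.1 ^ 2 * w z.1 * w z.2) ∂(ν.prod ν)) +
      ∫ z : ℝ × ℝ, Real.sign (z.1 - z.2) * (w z.1 * (z.2 ^ 2 * w z.2)) ∂(ν.prod ν) = 0 := by
    rw [← integral_add hA hB]
    refine integral_antisymm_prod ν _ fun z => ?_
    simp only [Prod.fst_swap, Prod.snd_swap]
    rw [← neg_sub z.1 z.2, Real.sign_neg]
    ring
  have e3 : ∫ z : ℝ × ℝ, Real.sign (z.1 - z.2) * (w z.1 * w z.2) ∂(ν.prod ν) = 0 := by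
    refine integral_antisymm_prod ν _ fun z => ?_
    simp only [Prod.fst_swap, Prod.snd_swap]
    rw [← neg_sub z.1 z.2, Real.sign_neg]
    ring
  have e4 : ∫ t, t * w t * w t ∂ν = ((2 * m + 1).factorial : ℝ) / (2 * 2 ^ (2 * m + 2)) := by
    rw [← integral_odd_pow_mul_exp_neg_sq two_pos (2 * m + 1)]
    congr 1
    ext t
    have : Real.exp (-2 * t ^ 2) = Real.exp (-t ^ 2) * Real.exp (-t ^ 2) := by
      rw [← Real.exp_add]
      congr 1
      ring
    simp only [hw, radialWeight, this]
    ring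
  have e5 : ∫ z : ℝ × ℝ, Real.sign (z.1 - z.2) * (z.1 ^ 2 * w z.1 * w z.2) ∂(ν.prod ν) =
      ∫ t, t * w t * w t ∂ν := by
    have hC' := hC.const_mul ((m : ℝ) + 1)
    have hsub : Integrable (fun z : ℝ × ℝ =>
        Real.sign (z.1 - z.2) * (z.1 ^ 2 * w z.1 * w z.2) -
          (m + 1) * (Real.sign (z.1 - z.2) * (w z.1 * w z.2))) (ν.prod ν) := hA.sub hC'
    -- Subtracting a multiple of the vanishing integral `e3` before Fubini makes the inner integral
    -- collapse to `t * w t`.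
    have : ∫ z : ℝ × ℝ, Real.sign (z.1 - z.2) * (z.1 ^ 2 * w z.1 * w z.2) ∂(ν.prod ν) =
        ∫ z : ℝ × ℝ, (Real.sign (z.1 - z.2) * (z.1 ^ 2 * w z.1 * w z.2) -
          (m + 1) * (Real.sign (z.1 - z.2) * (w z.1 * w z.2))) ∂(ν.prod ν) := by
      rw [integral_sub hA hC', integral_const_mul, e3]
      ring
    rw [this, integral_prod_symm _ hsub]
    refine setIntegral_congr_fun measurableSet_Ioi fun t ht => ?_
    have hk := integral_sign_mul_sq_mul_radialWeight m ht
    have : ∀ s, Real.sign (s - t) * (s ^ 2 * w s * w t) -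
          (m + 1) * (Real.sign (s - t) * (w s * w t)) =
        (Real.sign (s - t) * (s ^ 2 * w s) - (m + 1) * (Real.sign (s - t) * w s)) * w t := by
      intro s
      ring
    simp only [this]
    rw [integral_mul_const, integral_sub (integrable_sign_sub_mul hi2 t)
      ((integrable_sign_sub_mul hi1 t).const_mul _), integral_const_mul, hk]
    ring
  have h4 : (4 : ℝ) ^ (m + 1) = 2 ^ (2 * m + 2) := by
    rw [show (4 : ℝ) = 2 ^ 2 by norm_num, ← pow_mul]
    congr 1
  have e6 : ∫ z : ℝ × ℝ, |z.1 ^ 2 - z.2 ^ 2| * (w z.1 * w z.2) ∂(ν.prod ν) =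
      2 * (((2 * m + 1).factorial : ℝ) / (2 * 2 ^ (2 * m + 2))) := by
    linarith
  rw [e6, h4]
  field_simp

/-! ### Bounds on the central binomial coefficient -/

/-- The Wallis product is `2^(4r) r!⁴ / ((2r)!² (2r + 1))`, so bounds around `π / 2` for it become
bounds for the central binomial coefficient. -/
theorem sq_choose_div_four_pow (r : ℕ) :
    (((2 * r).choose r : ℝ) / 4 ^ r) ^ 2 * (Real.Wallis.W r * (2 * r + 1)) = 1 := by
  have hc : ((2 * r).choose r : ℝ) * (r.factorial * r.factorial) = (2 * r).factorial := by
    have h := Nat.choose_mul_factorial_mul_factorial (show r ≤ 2 * r by omega)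
    rw [show 2 * r - r = r by omega] at h
    rw [← mul_assoc]
    exact_mod_cast h
  have h4 : (2 : ℝ) ^ (4 * r) = (4 ^ r) ^ 2 := by
    rw [← pow_mul, show (4 : ℝ) = 2 ^ 2 by norm_num, ← pow_mul]
    congr 1
    ring
  have hf : (r.factorial : ℝ) ≠ 0 := by exact_mod_cast r.factorial_ne_zero
  have hch : ((2 * r).choose r : ℝ) ≠ 0 := by
    exact_mod_cast (Nat.choose_pos (show r ≤ 2 * r by omega)).ne'
  have hr : (2 * (r : ℝ) + 1) ≠ 0 := by positivity
  rw [Real.Wallis.W_eq_factorial_ratio, ← hc, h4]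
  field_simp

theorem choose_div_four_pow_sq_ge (r : ℕ) :
    2 / (Real.pi * (2 * r + 1)) ≤ (((2 * r).choose r : ℝ) / 4 ^ r) ^ 2 := by
  have h := sq_choose_div_four_pow r
  have hW := Real.Wallis.W_le r
  have hpi := Real.pi_pos
  set a := (((2 * r).choose r : ℝ) / 4 ^ r) ^ 2
  have ha : 0 ≤ a := sq_nonneg _
  have hr : (0 : ℝ) ≤ r := r.cast_nonneg
  rw [div_le_iff₀ (by positivity)]
  have : a * (Real.Wallis.W r * (2 * r + 1)) ≤ a * (Real.pi / 2 * (2 * r + 1)) := by gcongr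
  linarith

/-- After the lower bound for the Wallis product, what remains is `4r(r + 1) ≤ (2r + 1)²`. -/
theorem choose_div_four_pow_sq_le (r : ℕ) (hr : 0 < r) :
    (((2 * r).choose r : ℝ) / 4 ^ r) ^ 2 ≤ 1 / (Real.pi * r) := by
  have h := sq_choose_div_four_pow r
  have hW := Real.Wallis.le_W r
  have hpi := Real.pi_pos
  set a := (((2 * r).choose r : ℝ) / 4 ^ r) ^ 2
  have ha : 0 ≤ a := sq_nonneg _
  have hr : (0 : ℝ) < r := by exact_mod_cast hr
  rw [le_div_iff₀ (by positivity), ← h]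
  refine mul_le_mul_of_nonneg_left ?_ ha
  refine le_trans ?_ (mul_le_mul_of_nonneg_right hW (by positivity))
  rw [div_mul_div_comm, div_mul_eq_mul_div, le_div_iff₀ (by positivity)]
  nlinarith

theorem abs_choose_div_four_pow_sub_le (r : ℕ) (hr : 0 < r) :
    |((2 * r).choose r : ℝ) / 4 ^ r - 1 / Real.sqrt (Real.pi * r)| ≤
      1 / (r * Real.sqrt r) := by
  have h1 := choose_div_four_pow_sq_ge r
  have h2 := choose_div_four_pow_sq_le r hr
  have hpi := Real.pi_gt_three
  have hr' : (0 : ℝ) < r := by exact_mod_cast hr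
  set a := ((2 * r).choose r : ℝ) / 4 ^ r
  have ha : 0 ≤ a := by positivity
  set q := Real.sqrt (Real.pi * r) with hq
  have hqp : 0 < q := Real.sqrt_pos.mpr (by positivity)
  have hq2 : q ^ 2 = Real.pi * r := Real.sq_sqrt (by positivity)
  have hb2 : (1 / q) ^ 2 = 1 / (Real.pi * r) := by rw [div_pow, hq2, one_pow]
  have hab : a ≤ 1 / q := by
    refine (sq_le_sq₀ ha (by positivity)).mp ?_
    rw [hb2]; exact h2
  rw [abs_sub_comm, abs_of_nonneg (sub_nonneg.mpr hab)]
  -- As `a ≥ 0`, the product is at most `(1/q)² - a²`, where the bounds on `a²` apply.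
  have key : (1 / q - a) * (1 / q) ≤ 1 / (Real.pi * r) - 2 / (Real.pi * (2 * r + 1)) := by
    have : (1 / q - a) * (1 / q) ≤ (1 / q - a) * (1 / q + a) :=
      mul_le_mul_of_nonneg_left (by linarith) (by linarith)
    nlinarith
  have key2 : 1 / (Real.pi * r) - 2 / (Real.pi * (2 * r + 1)) ≤ 1 / (2 * Real.pi * r ^ 2) := by
    rw [div_sub_div _ _ (by positivity) (by positivity),
      div_le_div_iff₀ (by positivity) (by positivity)]
    have : 0 < Real.pi ^ 2 * r ^ 2 := by positivity
    nlinarith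
  have h3 : 1 / q - a ≤ q / (2 * Real.pi * r ^ 2) := by
    have := key.trans key2
    rw [mul_one_div, div_le_iff₀ hqp] at this
    rw [show q / (2 * Real.pi * r ^ 2) = 1 / (2 * Real.pi * r ^ 2) * q by ring]
    exact this
  refine h3.trans ?_
  have hs : 0 < Real.sqrt r := Real.sqrt_pos.mpr hr'
  have hs2 : Real.sqrt r * Real.sqrt r = r := Real.mul_self_sqrt hr'.le
  have hqs : q = Real.sqrt Real.pi * Real.sqrt r := Real.sqrt_mul (by positivity) _
  have hp : Real.sqrt Real.pi ≤ Real.pi := by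
    rw [Real.sqrt_le_left (by positivity)]
    nlinarith
  rw [div_le_div_iff₀ (by positivity) (by positivity), hqs, one_mul]
  calc Real.sqrt Real.pi * Real.sqrt r * (r * Real.sqrt r)
      = Real.sqrt Real.pi * r ^ 2 := by
        rw [show Real.sqrt Real.pi * Real.sqrt r * (r * Real.sqrt r) =
          Real.sqrt Real.pi * r * (Real.sqrt r * Real.sqrt r) by ring, hs2]
        ring
    _ ≤ 2 * Real.pi * r ^ 2 := by
        gcongr
        linarith

/-! ### Gaussian integrals over `E × E` -/

theorem integrable_pow_norm_mul_exp {E : Type*} [NormedAddCommGroup E] [NormedSpace ℝ E]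
    [MeasurableSpace E] [BorelSpace E] [FiniteDimensional ℝ E] [Nontrivial E] (μ : Measure E)
    [μ.IsAddHaarMeasure] (k : ℕ) : Integrable (fun x => ‖x‖ ^ k * Real.exp (-‖x‖ ^ 2)) μ := by
  rw [integrable_fun_norm_addHaar μ (f := fun s => s ^ k * Real.exp (-s ^ 2))]
  refine (integrableOn_pow_mul_exp_neg_sq one_pos (Module.finrank ℝ E - 1 + k)).congr_fun
    (fun s _ => ?_) measurableSet_Ioi
  simp only [smul_eq_mul, pow_add, neg_mul, one_mul]
  ring

theorem integrable_gaussian_sq_norm_add {E : Type*} [NormedAddCommGroup E] [NormedSpace ℝ E]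
    [MeasurableSpace E] [BorelSpace E] [FiniteDimensional ℝ E] [Nontrivial E] (μ : Measure E)
    [μ.IsAddHaarMeasure] :
    Integrable (fun z : E × E => (‖z.1‖ ^ 2 + ‖z.2‖ ^ 2) * Real.exp (-(‖z.1‖ ^ 2 + ‖z.2‖ ^ 2)))
      (μ.prod μ) := by
  have h0 := integrable_pow_norm_mul_exp μ 0
  have h2 := integrable_pow_norm_mul_exp μ 2
  refine (integrable_congr (Filter.Eventually.of_forall fun z => ?_)).mp
    ((h2.mul_prod h0).add (h0.mul_prod h2))
  simp only [Pi.add_apply, neg_add, Real.exp_add]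
  ring

theorem integrable_gaussian_abs_sq_norm_sub {E : Type*} [NormedAddCommGroup E] [NormedSpace ℝ E]
    [MeasurableSpace E] [BorelSpace E] [FiniteDimensional ℝ E] [Nontrivial E] (μ : Measure E)
    [μ.IsAddHaarMeasure] :
    Integrable (fun z : E × E => |‖z.1‖ ^ 2 - ‖z.2‖ ^ 2| * Real.exp (-(‖z.1‖ ^ 2 + ‖z.2‖ ^ 2)))
      (μ.prod μ) := by
  refine (integrable_gaussian_sq_norm_add μ).mono' (by fun_prop)
    (Filter.Eventually.of_forall fun z => ?_)
  rw [norm_mul, Real.norm_eq_abs, abs_abs, Real.norm_eq_abs, Real.abs_exp]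
  gcongr
  rw [abs_le]
  constructor <;> nlinarith [sq_nonneg ‖z.1‖, sq_nonneg ‖z.2‖]

theorem integral_pow_norm_mul_exp {E : Type*} [NormedAddCommGroup E] [NormedSpace ℝ E]
    [MeasurableSpace E] [BorelSpace E] [FiniteDimensional ℝ E] [Nontrivial E] (μ : Measure E)
    [μ.IsAddHaarMeasure] {m : ℕ} (hm : Module.finrank ℝ E = 2 * m + 2) (k : ℕ) :
    ∫ x, ‖x‖ ^ k * Real.exp (-‖x‖ ^ 2) ∂μ =
      (2 * m + 2) * μ.real (Metric.ball 0 1) * ∫ s in Set.Ioi (0 : ℝ), s ^ k * radialWeight m s := by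
  rw [integral_fun_norm_addHaar μ (fun s => s ^ k * Real.exp (-s ^ 2)), hm,
    show 2 * m + 2 - 1 = 2 * m + 1 by omega, nsmul_eq_mul, smul_eq_mul, mul_assoc]
  push_cast
  congr 3
  ext s
  simp only [radialWeight, smul_eq_mul]
  ring

theorem integral_gaussian_sq_norm_add {E : Type*} [NormedAddCommGroup E] [NormedSpace ℝ E]
    [MeasurableSpace E] [BorelSpace E] [FiniteDimensional ℝ E] [Nontrivial E] (μ : Measure E)
    [μ.IsAddHaarMeasure] {m : ℕ} (hm : Module.finrank ℝ E = 2 * m + 2) :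
    ∫ z : E × E, (‖z.1‖ ^ 2 + ‖z.2‖ ^ 2) * Real.exp (-(‖z.1‖ ^ 2 + ‖z.2‖ ^ 2)) ∂(μ.prod μ) =
      ((2 * m + 2) * μ.real (Metric.ball 0 1)) ^ 2 *
        ((m.factorial : ℝ) * (m + 1).factorial / 2) := by
  have h0 := integrable_pow_norm_mul_exp μ 0
  have h2 := integrable_pow_norm_mul_exp μ 2
  have e : ∀ z : E × E, (‖z.1‖ ^ 2 + ‖z.2‖ ^ 2) * Real.exp (-(‖z.1‖ ^ 2 + ‖z.2‖ ^ 2)) =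
      ‖z.1‖ ^ 2 * Real.exp (-‖z.1‖ ^ 2) * (‖z.2‖ ^ 0 * Real.exp (-‖z.2‖ ^ 2)) +
      ‖z.1‖ ^ 0 * Real.exp (-‖z.1‖ ^ 2) * (‖z.2‖ ^ 2 * Real.exp (-‖z.2‖ ^ 2)) := by
    intro z
    simp only [neg_add, Real.exp_add]
    ring
  simp only [e]
  rw [integral_add (h2.mul_prod h0) (h0.mul_prod h2),
    integral_prod_mul (fun x : E => ‖x‖ ^ 2 * Real.exp (-‖x‖ ^ 2))
      (fun x : E => ‖x‖ ^ 0 * Real.exp (-‖x‖ ^ 2)),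
    integral_prod_mul (fun x : E => ‖x‖ ^ 0 * Real.exp (-‖x‖ ^ 2))
      (fun x : E => ‖x‖ ^ 2 * Real.exp (-‖x‖ ^ 2)),
    integral_pow_norm_mul_exp μ hm, integral_pow_norm_mul_exp μ hm]
  simp only [pow_zero, one_mul]
  rw [integral_radialWeight, integral_sq_mul_radialWeight]
  ring

/-- Polar coordinates are used in one factor at a time. The sphere constant comes out squared, as in
`integral_gaussian_sq_norm_add`, and cancels in the quotient. -/
theorem integral_gaussian_abs_sq_norm_sub {E : Type*} [NormedAddCommGroup E] [NormedSpace ℝ E]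
    [MeasurableSpace E] [BorelSpace E] [FiniteDimensional ℝ E] [Nontrivial E] (μ : Measure E)
    [μ.IsAddHaarMeasure] {m : ℕ} (hm : Module.finrank ℝ E = 2 * m + 2) :
    ∫ z : E × E, |‖z.1‖ ^ 2 - ‖z.2‖ ^ 2| * Real.exp (-(‖z.1‖ ^ 2 + ‖z.2‖ ^ 2)) ∂(μ.prod μ) =
      ((2 * m + 2) * μ.real (Metric.ball 0 1)) ^ 2 *
        (((2 * m + 1).factorial : ℝ) / 4 ^ (m + 1)) := by
  rw [← integral_abs_sq_sub_mul_radialWeight, integral_prod _ (integrable_gaussian_abs_sq_norm_sub μ),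
    integral_prod _ (integrable_abs_sq_sub_mul_radialWeight m)]
  have inner : ∀ a : ℝ, ∫ y, |a ^ 2 - ‖y‖ ^ 2| * Real.exp (-(a ^ 2 + ‖y‖ ^ 2)) ∂μ =
      (2 * m + 2) * μ.real (Metric.ball 0 1) *
        (Real.exp (-a ^ 2) * ∫ t in Set.Ioi (0 : ℝ), |a ^ 2 - t ^ 2| * radialWeight m t) := by
    intro a
    rw [integral_fun_norm_addHaar μ (fun t => |a ^ 2 - t ^ 2| * Real.exp (-(a ^ 2 + t ^ 2))), hm,
      show 2 * m + 2 - 1 = 2 * m + 1 by omega, nsmul_eq_mul, smul_eq_mul]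
    have e : ∀ t : ℝ, t ^ (2 * m + 1) • (|a ^ 2 - t ^ 2| * Real.exp (-(a ^ 2 + t ^ 2))) =
        Real.exp (-a ^ 2) * (|a ^ 2 - t ^ 2| * radialWeight m t) := by
      intro t
      simp only [radialWeight, smul_eq_mul, neg_add, Real.exp_add]
      ring
    simp only [e]
    rw [integral_const_mul]
    push_cast
    ring
  simp only [inner]
  rw [integral_const_mul, integral_fun_norm_addHaar μ (fun a => Real.exp (-a ^ 2) *
    ∫ t in Set.Ioi (0 : ℝ), |a ^ 2 - t ^ 2| * radialWeight m t), hm,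
    show 2 * m + 2 - 1 = 2 * m + 1 by omega, nsmul_eq_mul, smul_eq_mul, sq, mul_assoc, mul_assoc,
    mul_assoc, mul_assoc]
  push_cast
  congr 5
  ext s
  simp only [smul_eq_mul]
  rw [← mul_assoc, ← integral_const_mul]
  congr 1
  ext t
  simp only [radialWeight]
  ring

/-- A linear map scales Haar measure by a determinant factor. Here it fixes a set of finite positive
measure, the unit ball of the quadratic form, so the factor is `1`. -/
theorem measurePreserving_of_sq_norm_add {E : Type*} [NormedAddCommGroup E] [NormedSpace ℝ E]
    [MeasurableSpace E] [BorelSpace E] [FiniteDimensional ℝ E] (μ : Measure E)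
    [μ.IsAddHaarMeasure] (T : E × E →ₗ[ℝ] E × E)
    (hT : ∀ v, ‖(T v).1‖ ^ 2 + ‖(T v).2‖ ^ 2 = ‖v.1‖ ^ 2 + ‖v.2‖ ^ 2) :
    MeasurePreserving T (μ.prod μ) (μ.prod μ) := by
  have hker : LinearMap.ker T = ⊥ := by
    rw [LinearMap.ker_eq_bot']
    intro v hv
    have h := hT v
    rw [hv] at h
    simp only [Prod.fst_zero, Prod.snd_zero, norm_zero] at h
    have h1 : ‖v.1‖ = 0 := by
      have := sq_nonneg ‖v.1‖
      have := sq_nonneg ‖v.2‖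
      exact pow_eq_zero_iff two_ne_zero |>.mp (by linarith)
    have h2 : ‖v.2‖ = 0 := by
      have := sq_nonneg ‖v.1‖
      have := sq_nonneg ‖v.2‖
      exact pow_eq_zero_iff two_ne_zero |>.mp (by linarith)
    exact Prod.ext (norm_eq_zero.mp h1) (norm_eq_zero.mp h2)
  have hdet : LinearMap.det T ≠ 0 := fun h => (LinearMap.bot_lt_ker_of_det_eq_zero h).ne' hker
  refine ⟨T.continuous_of_finiteDimensional.measurable, ?_⟩
  set S : Set (E × E) := {v | ‖v.1‖ ^ 2 + ‖v.2‖ ^ 2 ≤ 1}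
  have hpre : T ⁻¹' S = S := by
    ext v
    simp only [S, Set.mem_preimage, Set.mem_ofPred_eq, hT]
  -- The norm on `E × E` is the sup norm, so `S` is not one of its balls; it lies between those of
  -- radius `1/2` and `1`.
  have hS0 : (μ.prod μ) S ≠ 0 := by
    refine (lt_of_lt_of_le (Metric.measure_ball_pos (μ.prod μ) 0 (r := 1 / 2) (by norm_num))
      (measure_mono fun v hv => ?_)).ne'
    rw [mem_ball_zero_iff, Prod.norm_def, max_lt_iff] at hv
    have h1 := norm_nonneg v.1
    have h2 := norm_nonneg v.2
    simp only [S, Set.mem_ofPred_eq]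
    nlinarith
  have hS1 : (μ.prod μ) S ≠ ⊤ := by
    refine ne_top_of_le_ne_top (measure_closedBall_lt_top (μ := μ.prod μ) (x := 0) (r := 1)).ne
      (measure_mono fun v hv => ?_)
    simp only [S, Set.mem_ofPred_eq] at hv
    rw [mem_closedBall_zero_iff, Prod.norm_def, max_le_iff]
    have h1 := norm_nonneg v.1
    have h2 := norm_nonneg v.2
    constructor <;> nlinarith
  have hc : ENNReal.ofReal |(LinearMap.det T)⁻¹| = 1 := by
    have h := Measure.addHaar_preimage_linearMap (μ.prod μ) hdet S
    rw [hpre] at h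
    exact (ENNReal.mul_eq_right hS0 hS1).mp h.symm
  rw [Measure.map_linearMap_addHaar_eq_smul_addHaar (μ.prod μ) hdet, hc, one_smul]

/-! ### Averaging over the unitary group -/

instance unitaryGroupSecondCountable (d : ℕ) :
    SecondCountableTopology (unitaryGroup (Fin d) ℂ) := by
  have : SecondCountableTopology (Matrix (Fin d) (Fin d) ℂ) :=
    inferInstanceAs (SecondCountableTopology (Fin d → Fin d → ℂ))
  exact TopologicalSpace.Subtype.secondCountableTopology _

instance haarUnitaryIsMulLeftInvariant (d : ℕ) : (haarUnitary d).IsMulLeftInvariant := by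
  unfold haarUnitary
  infer_instance

theorem sum_sq_norm_vecMul_unitary {n : Type*} [Fintype n] [DecidableEq n]
    (U : unitaryGroup n ℂ) (x : n → ℂ) :
    ∑ j, ‖(x ᵥ* (U : Matrix n n ℂ)) j‖ ^ 2 = ∑ j, ‖x j‖ ^ 2 := by
  have key : ∀ y : n → ℂ, ((∑ j, ‖y j‖ ^ 2 : ℝ) : ℂ) = y ⬝ᵥ star y := by
    intro y
    simp only [dotProduct, Pi.star_apply, Complex.ofReal_sum]
    refine Finset.sum_congr rfl fun j _ => ?_
    rw [RCLike.star_def, Complex.mul_conj, Complex.normSq_eq_norm_sq]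
  have hU : (U : Matrix n n ℂ) * (U : Matrix n n ℂ)ᴴ = 1 := mem_unitaryGroup_iff.mp U.2
  have : ((∑ j, ‖(x ᵥ* (U : Matrix n n ℂ)) j‖ ^ 2 : ℝ) : ℂ) = ((∑ j, ‖x j‖ ^ 2 : ℝ) : ℂ) := by
    rw [key, key, star_vecMul, ← dotProduct_mulVec, mulVec_mulVec, hU, one_mulVec]
  exact_mod_cast this

/-- A unit vector extends to an orthonormal basis having it at index `i`; the basis vectors are the
rows. -/
theorem exists_unitary_row_eq {n : Type*} [Fintype n] [DecidableEq n] (i : n) (x : n → ℂ)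
    (hx : ∑ j, ‖x j‖ ^ 2 = 1) : ∃ U : unitaryGroup n ℂ, (U : Matrix n n ℂ) i = x := by
  have hnorm : ‖(WithLp.toLp 2 x : EuclideanSpace ℂ n)‖ = 1 := by
    rw [EuclideanSpace.norm_eq]
    simp [hx]
  have hon : Orthonormal ℂ
      (({i} : Set n).domRestrict fun _ => (WithLp.toLp 2 x : EuclideanSpace ℂ n)) := by
    refine ⟨fun _ => hnorm, fun a b hab => absurd (Subsingleton.elim a b) hab⟩
  obtain ⟨b, hb⟩ := Orthonormal.exists_orthonormalBasis_extension_of_card_eq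
    (finrank_euclideanSpace (𝕜 := ℂ) (ι := n)) hon
  refine ⟨⟨Matrix.of fun k j => b k j, mem_unitaryGroup_iff.mpr ?_⟩, ?_⟩
  · ext k l
    -- The indices are reversed because the inner product is conjugate-linear in its first argument.
    have h := orthonormal_iff_ite.mp b.orthonormal l k
    rw [PiLp.inner_apply] at h
    rw [Matrix.mul_apply, Matrix.one_apply]
    simp only [star_apply, of_apply]
    simp only [eq_comm (a := l)] at h
    rw [← h]
    rfl
  · funext j
    simp [hb i rfl]

/-- The Haar average of a function, homogeneous of degree two, of `x U`. -/
theorem integral_vecMul_haarUnitary {d : ℕ} (F : (Fin d → ℂ) → ℝ)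
    (hF : ∀ (c : ℝ) x, F ((c : ℂ) • x) = c ^ 2 * F x) (i : Fin d) (x : Fin d → ℂ) :
    ∫ U, F (x ᵥ* (U : Matrix (Fin d) (Fin d) ℂ)) ∂(haarUnitary d) =
      (∑ j, ‖x j‖ ^ 2) *
        ∫ U, F ((U : Matrix (Fin d) (Fin d) ℂ) i) ∂(haarUnitary d) := by
  set q := ∑ j, ‖x j‖ ^ 2 with hq
  have hq0 : 0 ≤ q := Finset.sum_nonneg fun j _ => sq_nonneg _
  rcases hq0.eq_or_lt with h | h
  · have hx : x = 0 := by
      funext j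
      have := (Finset.sum_eq_zero_iff_of_nonneg fun j _ => sq_nonneg ‖x j‖).mp h.symm j
        (Finset.mem_univ j)
      simpa using this
    have h0 : F 0 = 0 := by simpa using hF 0 0
    rw [← h]
    simp [hx, h0]
  · set c := Real.sqrt q with hc
    have hc0 : c ≠ 0 := (Real.sqrt_pos.mpr h).ne'
    have hc2 : c ^ 2 = q := Real.sq_sqrt hq0
    obtain ⟨V, hV⟩ := exists_unitary_row_eq i (((c⁻¹ : ℝ) : ℂ) • x) (by
      simp only [Pi.smul_apply, smul_eq_mul, norm_mul, mul_pow, ← Finset.mul_sum,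
        Complex.norm_real, Real.norm_eq_abs, sq_abs]
      rw [← hq, ← hc2]
      field_simp)
    have hx : x = (c : ℂ) • (V : Matrix (Fin d) (Fin d) ℂ) i := by
      rw [hV, smul_smul, ← Complex.ofReal_mul, mul_inv_cancel₀ hc0]
      simp
    -- Since `x = c • V i`, the vector `x U` is `c` times row `i` of `V U`; left invariance absorbs
    -- `V` and homogeneity extracts `c²`.
    rw [← integral_mul_left_eq_self (μ := haarUnitary d)
      (fun U : unitaryGroup (Fin d) ℂ => F ((U : Matrix (Fin d) (Fin d) ℂ) i)) V,
      ← integral_const_mul]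
    congr 1
    funext U
    rw [← hc2, ← hF]
    congr 1
    conv_lhs => rw [hx]
    rw [smul_vecMul]
    rfl

/-! ### Splitting `ℂ^(2r)` into two halves -/

/-- `‖x₀‖² - ‖x₁‖²` for the two halves `x₀, x₁ ∈ ℂ^r` of `x`. -/
noncomputable def halfDiff (r : ℕ) (x : Fin (r * 2) → ℂ) : ℝ :=
  ∑ j : Fin (r * 2), (if (j : ℕ) < r then (1 : ℝ) else -1) * ‖x j‖ ^ 2

theorem continuous_halfDiff (r : ℕ) : Continuous (halfDiff r) := by
  unfold halfDiff
  fun_prop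

theorem abs_halfDiff_le (r : ℕ) (x : Fin (r * 2) → ℂ) : |halfDiff r x| ≤ ∑ j, ‖x j‖ ^ 2 := by
  refine (Finset.abs_sum_le_sum_abs _ _).trans (Finset.sum_le_sum fun j _ => ?_)
  rw [abs_mul, abs_of_nonneg (sq_nonneg ‖x j‖)]
  split_ifs <;> simp

theorem halfDiff_smul (r : ℕ) (c : ℝ) (x : Fin (r * 2) → ℂ) :
    halfDiff r ((c : ℂ) • x) = c ^ 2 * halfDiff r x := by
  simp only [halfDiff, Finset.mul_sum, Pi.smul_apply, smul_eq_mul, norm_mul, mul_pow,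
    Complex.norm_real, Real.norm_eq_abs, sq_abs]
  exact Finset.sum_congr rfl fun j _ => by ring

/-- The two halves of the index set of `ℂ^(2r)`. -/
def halvesEquiv (r : ℕ) : Fin r ⊕ Fin r ≃ Fin (r * 2) :=
  finSumFinEquiv.trans (finCongr (by omega))

/-- `ℂ^r × ℂ^r ≃ ℂ^(2r)`. -/
noncomputable def joinHalves (r : ℕ) :
    (EuclideanSpace ℂ (Fin r) × EuclideanSpace ℂ (Fin r)) ≃ₗ[ℝ] (Fin (r * 2) → ℂ) where
  toFun v k := Sum.elim (fun j => v.1 j) (fun j => v.2 j) ((halvesEquiv r).symm k)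
  invFun x := (WithLp.toLp 2 fun j => x (halvesEquiv r (Sum.inl j)),
    WithLp.toLp 2 fun j => x (halvesEquiv r (Sum.inr j)))
  map_add' v w := by
    funext k
    rcases h : (halvesEquiv r).symm k with j | j <;> simp [h]
  map_smul' c v := by
    funext k
    rcases h : (halvesEquiv r).symm k with j | j <;> simp [h]
  left_inv v := by
    refine Prod.ext ?_ ?_ <;> ext j <;> simp
  right_inv x := by
    funext k
    obtain ⟨l, rfl⟩ := (halvesEquiv r).surjective k
    rcases l with j | j <;> simp

theorem sum_sq_norm_joinHalves (r : ℕ) (v : EuclideanSpace ℂ (Fin r) × EuclideanSpace ℂ (Fin r)) :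
    ∑ j, ‖joinHalves r v j‖ ^ 2 = ‖v.1‖ ^ 2 + ‖v.2‖ ^ 2 := by
  rw [← (halvesEquiv r).sum_comp, Fintype.sum_sum_type, EuclideanSpace.norm_sq_eq,
    EuclideanSpace.norm_sq_eq]
  simp [joinHalves]

theorem halfDiff_joinHalves (r : ℕ) (v : EuclideanSpace ℂ (Fin r) × EuclideanSpace ℂ (Fin r)) :
    halfDiff r (joinHalves r v) = ‖v.1‖ ^ 2 - ‖v.2‖ ^ 2 := by
  rw [halfDiff, ← (halvesEquiv r).sum_comp, Fintype.sum_sum_type, EuclideanSpace.norm_sq_eq,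
    EuclideanSpace.norm_sq_eq]
  have hl : ∀ j : Fin r, ((halvesEquiv r (Sum.inl j) : Fin (r * 2)) : ℕ) < r := fun j => j.2
  have hr : ∀ j : Fin r, ¬ ((halvesEquiv r (Sum.inr j) : Fin (r * 2)) : ℕ) < r := by
    intro j
    simp [halvesEquiv]
  simp only [hl, hr, if_true, if_false]
  simp [joinHalves, sub_eq_add_neg]

/-- Right multiplication by a unitary, read on `ℂ^r × ℂ^r`. -/
noncomputable def halvesVecMul (r : ℕ) (U : Matrix (Fin (r * 2)) (Fin (r * 2)) ℂ) :
    (EuclideanSpace ℂ (Fin r) × EuclideanSpace ℂ (Fin r)) →ₗ[ℝ]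
      (EuclideanSpace ℂ (Fin r) × EuclideanSpace ℂ (Fin r)) :=
  (joinHalves r).symm.toLinearMap ∘ₗ (U.vecMulLinear.restrictScalars ℝ) ∘ₗ
    (joinHalves r).toLinearMap

theorem joinHalves_halvesVecMul (r : ℕ) (U : Matrix (Fin (r * 2)) (Fin (r * 2)) ℂ)
    (v : EuclideanSpace ℂ (Fin r) × EuclideanSpace ℂ (Fin r)) :
    joinHalves r (halvesVecMul r U v) = joinHalves r v ᵥ* U := by
  simp [halvesVecMul]

theorem continuous_joinHalves (r : ℕ) : Continuous (joinHalves r) :=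
  (joinHalves r).toLinearMap.continuous_of_finiteDimensional

/-- The Gaussian integral of `|halfDiff (v U)|`, averaged over `U`, is evaluated in both orders. For
fixed `U` the rotation disappears by invariance of the Gaussian (`hinv`); for fixed `v` the Haar
average is `‖v‖²` times the mean over a row (`hav`). -/
theorem integral_gaussian_halfDiff (r : ℕ) [NeZero r] (i : Fin (r * 2))
    (μ : Measure (EuclideanSpace ℂ (Fin r))) [μ.IsAddHaarMeasure] :
    ∫ v, |‖v.1‖ ^ 2 - ‖v.2‖ ^ 2| * Real.exp (-(‖v.1‖ ^ 2 + ‖v.2‖ ^ 2)) ∂(μ.prod μ) =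
      (∫ v, (‖v.1‖ ^ 2 + ‖v.2‖ ^ 2) * Real.exp (-(‖v.1‖ ^ 2 + ‖v.2‖ ^ 2)) ∂(μ.prod μ)) *
        ∫ U, |halfDiff r ((U : Matrix (Fin (r * 2)) (Fin (r * 2)) ℂ) i)|
          ∂(haarUnitary (r * 2)) := by
  set I := ∫ U, |halfDiff r ((U : Matrix (Fin (r * 2)) (Fin (r * 2)) ℂ) i)|
          ∂(haarUnitary (r * 2)) with hI
  have hav : ∀ v : EuclideanSpace ℂ (Fin r) × EuclideanSpace ℂ (Fin r),
      ∫ U, |halfDiff r (joinHalves r v ᵥ* (U : Matrix (Fin (r * 2)) (Fin (r * 2)) ℂ))| *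
        Real.exp (-(‖v.1‖ ^ 2 + ‖v.2‖ ^ 2)) ∂(haarUnitary (r * 2)) =
      (‖v.1‖ ^ 2 + ‖v.2‖ ^ 2) * Real.exp (-(‖v.1‖ ^ 2 + ‖v.2‖ ^ 2)) * I := by
    intro v
    rw [integral_mul_const, integral_vecMul_haarUnitary (fun x => |halfDiff r x|)
      (fun c x => by rw [halfDiff_smul, abs_mul, abs_of_nonneg (sq_nonneg c)]) i,
      sum_sq_norm_joinHalves]
    ring
  have hinv : ∀ U : unitaryGroup (Fin (r * 2)) ℂ,
      ∫ v, |halfDiff r (joinHalves r v ᵥ* (U : Matrix (Fin (r * 2)) (Fin (r * 2)) ℂ))| *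
        Real.exp (-(‖v.1‖ ^ 2 + ‖v.2‖ ^ 2)) ∂(μ.prod μ) =
      ∫ v, |‖v.1‖ ^ 2 - ‖v.2‖ ^ 2| * Real.exp (-(‖v.1‖ ^ 2 + ‖v.2‖ ^ 2)) ∂(μ.prod μ) := by
    intro U
    have hT : ∀ v, ‖(halvesVecMul r U v).1‖ ^ 2 + ‖(halvesVecMul r U v).2‖ ^ 2 =
        ‖v.1‖ ^ 2 + ‖v.2‖ ^ 2 := by
      intro v
      rw [← sum_sq_norm_joinHalves, ← sum_sq_norm_joinHalves, joinHalves_halvesVecMul,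
        sum_sq_norm_vecMul_unitary]
    have hmp := measurePreserving_of_sq_norm_add μ (halvesVecMul r U) hT
    have hmeas : AEStronglyMeasurable
        (fun v : EuclideanSpace ℂ (Fin r) × EuclideanSpace ℂ (Fin r) =>
          |‖v.1‖ ^ 2 - ‖v.2‖ ^ 2| * Real.exp (-(‖v.1‖ ^ 2 + ‖v.2‖ ^ 2)))
        (Measure.map (halvesVecMul r U) (μ.prod μ)) :=
      Continuous.aestronglyMeasurable (by fun_prop)
    conv_rhs => rw [← hmp.map_eq]
    rw [integral_map hmp.measurable.aemeasurable hmeas]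
    congr 1
    funext v
    rw [hT, ← joinHalves_halvesVecMul, halfDiff_joinHalves]
  have hint : Integrable (Function.uncurry fun
      (v : EuclideanSpace ℂ (Fin r) × EuclideanSpace ℂ (Fin r))
      (U : unitaryGroup (Fin (r * 2)) ℂ) =>
        |halfDiff r (joinHalves r v ᵥ* (U : Matrix (Fin (r * 2)) (Fin (r * 2)) ℂ))| *
        Real.exp (-(‖v.1‖ ^ 2 + ‖v.2‖ ^ 2))) ((μ.prod μ).prod (haarUnitary (r * 2))) := by
    have hb := (integrable_gaussian_sq_norm_add μ).mul_prod
      (integrable_const (μ := haarUnitary (r * 2)) (1 : ℝ))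
    refine hb.mono' (Continuous.aestronglyMeasurable ?_) (Filter.Eventually.of_forall fun p => ?_)
    · have h1 : Continuous fun p : (EuclideanSpace ℂ (Fin r) × EuclideanSpace ℂ (Fin r)) ×
          unitaryGroup (Fin (r * 2)) ℂ =>
          joinHalves r p.1 ᵥ* (p.2 : Matrix (Fin (r * 2)) (Fin (r * 2)) ℂ) :=
        ((continuous_joinHalves r).comp continuous_fst).matrix_vecMul
          (continuous_subtype_val.comp continuous_snd)
      have h2 := ((continuous_halfDiff r).comp h1).abs
      exact h2.mul (by fun_prop)
    · simp only [Function.uncurry, norm_mul, Real.norm_eq_abs, abs_abs, Real.abs_exp, mul_one]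
      gcongr
      refine (abs_halfDiff_le r _).trans (le_of_eq ?_)
      rw [sum_sq_norm_vecMul_unitary, sum_sq_norm_joinHalves]
  have hswap := integral_integral_swap hint
  simp only [hav, hinv] at hswap
  rw [integral_mul_const, integral_const] at hswap
  rw [hswap]
  simp

theorem integral_abs_halfDiff (r : ℕ) [NeZero r] (i : Fin (r * 2)) :
    ∫ U, |halfDiff r ((U : Matrix (Fin (r * 2)) (Fin (r * 2)) ℂ) i)| ∂(haarUnitary (r * 2)) =
      ((2 * r).choose r : ℝ) / 4 ^ r := by
  -- The radial formulas are indexed by `m = r - 1`, the real dimension of `ℂ^r` being `2m + 2`.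
  obtain ⟨m, rfl⟩ := Nat.exists_eq_succ_of_ne_zero (NeZero.ne r)
  simp only [Nat.succ_eq_add_one] at *
  have hfin : Module.finrank ℝ (EuclideanSpace ℂ (Fin (m + 1))) = 2 * m + 2 := by
    rw [finrank_real_of_complex, finrank_euclideanSpace, Fintype.card_fin]
    ring
  have h := integral_gaussian_halfDiff (m + 1) i Measure.addHaar
  rw [integral_gaussian_abs_sq_norm_sub _ hfin, integral_gaussian_sq_norm_add _ hfin, mul_assoc] at h
  have hK : ((2 * (m : ℝ) + 2) * (Measure.addHaar : Measure (EuclideanSpace ℂ (Fin (m + 1)))).real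
      (Metric.ball 0 1)) ^ 2 ≠ 0 := by
    refine pow_ne_zero _ (mul_ne_zero (by positivity) ?_)
    exact (ENNReal.toReal_pos (Metric.measure_ball_pos _ _ one_pos).ne'
      measure_ball_lt_top.ne).ne'
  have h' := mul_left_cancel₀ hK h
  have hc : ((2 * (m + 1)).choose (m + 1) : ℝ) * ((m + 1).factorial * (m + 1).factorial) =
      (2 * (m + 1)).factorial := by
    have h := Nat.choose_mul_factorial_mul_factorial (show m + 1 ≤ 2 * (m + 1) by omega)
    rw [show 2 * (m + 1) - (m + 1) = m + 1 by omega] at h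
    rw [← mul_assoc]
    exact_mod_cast h
  have hf2 : ((2 * (m + 1)).factorial : ℝ) = (2 * m + 2) * (2 * m + 1).factorial := by
    rw [show 2 * (m + 1) = 2 * m + 1 + 1 by ring, Nat.factorial_succ]
    push_cast
    ring
  have hf1 : ((m + 1).factorial : ℝ) = (m + 1) * m.factorial := by
    rw [Nat.factorial_succ]
    push_cast
    ring
  have hm0 : (m.factorial : ℝ) ≠ 0 := by exact_mod_cast m.factorial_ne_zero
  have hm1 : ((m : ℝ) + 1) ≠ 0 := by positivity
  rw [hf2, hf1] at hc
  rw [hf1] at h'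
  have hc' : ((2 * m + 1).factorial : ℝ) =
      ((2 * (m + 1)).choose (m + 1) : ℝ) * ((m + 1) * m.factorial * m.factorial) / 2 := by
    have : (2 * ((m : ℝ) + 1)) * (2 * m + 1).factorial = (2 * ((m : ℝ) + 1)) *
      (((2 * (m + 1)).choose (m + 1) : ℝ) * ((m + 1) * m.factorial * m.factorial) / 2) := by
      linear_combination -hc
    exact mul_left_cancel₀ (by positivity) this
  rw [hc'] at h'
  have hn : (m.factorial : ℝ) * ((m + 1) * m.factorial) / 2 ≠ 0 := by positivity
  refine mul_left_cancel₀ hn ?_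
  rw [← h']
  ring

/-! ### Ciphertexts and measurement statistics -/

theorem sum_sq_norm_row_unitary {n : Type*} [Fintype n] [DecidableEq n] (U : unitaryGroup n ℂ)
    (i : n) : ∑ j, ‖(U : Matrix n n ℂ) i j‖ ^ 2 = 1 := by
  have h := sum_sq_norm_vecMul_unitary U (Pi.single i 1)
  rw [single_one_vecMul] at h
  refine h.trans ?_
  rw [Finset.sum_eq_single i] <;> simp +contextual

/-- The entry is `1/r` times the mass of row `i` in half `b`; the two masses have sum `1` and
difference `halfDiff`. -/
theorem cipher_diag_re (r : ℕ) [NeZero r] (U : unitaryGroup (Fin (r * 2)) ℂ) (b : Fin 2)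
    (i : Fin (r * 2)) :
    (((haarEncryption 2 r).cipher U b i i).re : ℝ) =
      (1 + (if b = 0 then 1 else -1) *
        halfDiff r ((U : Matrix (Fin (r * 2)) (Fin (r * 2)) ℂ) i)) / (2 * r) := by
  have hr : (r : ℝ) ≠ 0 := by exact_mod_cast NeZero.ne r
  have hrow := sum_sq_norm_row_unitary U i
  have hblock : blockState 2 r b = Matrix.diagonal fun j : Fin (r * 2) =>
      (1 / (r : ℂ)) * if r * (b : ℕ) ≤ (j : ℕ) ∧ (j : ℕ) < r * ((b : ℕ) + 1) then 1 else 0 := by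
    ext j k
    simp only [blockState, Matrix.smul_apply, Matrix.sum_apply, smul_eq_mul,
      Matrix.diagonal_apply]
    rw [Finset.sum_filter]
    simp only [Matrix.single_apply]
    by_cases hjk : j = k
    · subst hjk
      rw [Finset.sum_eq_single j] <;> simp +contextual
    · rw [if_neg hjk, Finset.sum_eq_zero, mul_zero]
      intro x _
      have : ¬(x = j ∧ x = k) := fun h => hjk (h.1.symm.trans h.2)
      simp [this]
  have hre : ((haarEncryption 2 r).cipher U b i i).re =
      ∑ j : Fin (r * 2), (1 / (r : ℝ)) *
        (if r * (b : ℕ) ≤ (j : ℕ) ∧ (j : ℕ) < r * ((b : ℕ) + 1) then 1 else 0) *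
        ‖(U : Matrix (Fin (r * 2)) (Fin (r * 2)) ℂ) i j‖ ^ 2 := by
    change (((U : Matrix (Fin (r * 2)) (Fin (r * 2)) ℂ) * blockState 2 r b *
      (U : Matrix (Fin (r * 2)) (Fin (r * 2)) ℂ)ᴴ) i i).re = _
    rw [hblock, Matrix.mul_apply, Complex.re_sum]
    refine Finset.sum_congr rfl fun j _ => ?_
    rw [Matrix.mul_diagonal, conjTranspose_apply, RCLike.star_def, mul_right_comm, Complex.mul_conj,
      Complex.normSq_eq_norm_sq]
    split_ifs <;> simp [mul_comm, ← Complex.ofReal_natCast,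
      ← Complex.ofReal_inv, -Complex.ofReal_pow]
  -- Writing `1` as the squared norm of the row lets the identity be checked coordinate by
  -- coordinate.
  have hone : ∀ h : ℝ, (1 + h) / (2 * r) =
      (∑ j, ‖(U : Matrix (Fin (r * 2)) (Fin (r * 2)) ℂ) i j‖ ^ 2 + h) / (2 * r) := by
    intro h
    rw [hrow]
  rw [hre, hone, halfDiff, Finset.mul_sum, ← Finset.sum_add_distrib, Finset.sum_div]
  refine Finset.sum_congr rfl fun j _ => ?_
  have hj : (j : ℕ) < r * 2 := j.2
  fin_cases b
  · by_cases h : (j : ℕ) < r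
    · simp [h]
      field_simp
      norm_num
    · simp [h]
  · by_cases h : (j : ℕ) < r
    · have : ¬ r ≤ (j : ℕ) := by omega
      simp [h, this]
    · have h' : r ≤ (j : ℕ) := by omega
      simp [h, h', hj]
      field_simp
      norm_num

theorem integrable_abs_halfDiff (r : ℕ) (V : unitaryGroup (Fin (r * 2)) ℂ) (i : Fin (r * 2)) :
    Integrable (fun U : unitaryGroup (Fin (r * 2)) ℂ =>
      |halfDiff r (((V * U : unitaryGroup (Fin (r * 2)) ℂ) :
        Matrix (Fin (r * 2)) (Fin (r * 2)) ℂ) i)|) (haarUnitary (r * 2)) := by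
  have hc : Continuous fun U : unitaryGroup (Fin (r * 2)) ℂ =>
      |halfDiff r (((V * U : unitaryGroup (Fin (r * 2)) ℂ) :
        Matrix (Fin (r * 2)) (Fin (r * 2)) ℂ) i)| := by
    have h1 : Continuous fun U : unitaryGroup (Fin (r * 2)) ℂ =>
        ((V * U : unitaryGroup (Fin (r * 2)) ℂ) : Matrix (Fin (r * 2)) (Fin (r * 2)) ℂ) :=
      continuous_subtype_val.comp (continuous_const.mul continuous_id)
    exact ((continuous_halfDiff r).comp ((continuous_apply i).comp h1)).abs
  exact hc.integrable_of_hasCompactSupport (HasCompactSupport.of_compactSpace _)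

theorem basisMeasurement_isMeasurementChannel (H : Type*) [Fintype H] [DecidableEq H] :
    IsMeasurementChannel (basisMeasurement H) := by
  refine ⟨fun i => Matrix.single i i 1, ⟨fun i _ => ?_, Matrix.sum_single_one⟩, fun ρ => ?_⟩
  · rw [← Matrix.diagonal_single]
    refine PosSemidef.diagonal fun k => ?_
    by_cases h : k = i
    · subst h; simp
    · simp [h]
  · rw [basisMeasurement_eq_diagonal]
    ext a b
    simp only [Matrix.diagonal_apply, Matrix.sum_apply, Matrix.smul_apply, smul_eq_mul,
      Matrix.single_apply, Matrix.trace_single_mul]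
    by_cases h : a = b
    · subst h
      simp
    · rw [if_neg h, Finset.sum_eq_zero]
      intro x _
      have : ¬(x = a ∧ x = b) := fun h' => h (h'.1.symm.trans h'.2)
      simp [this]

theorem winProb_basisAttack (r : ℕ) [NeZero r] :
    winProb (haarEncryption 2 r) (basisAttack r) =
      1 / 2 + 1 / 2 * (((2 * r).choose r : ℝ) / 4 ^ r) := by
  classical
  have hr : (r : ℝ) ≠ 0 := by exact_mod_cast NeZero.ne r
  have hint : ∀ U : unitaryGroup (Fin (r * 2)) ℂ,
      (1 / ((basisAttack r).messages.card : ℝ)) * ∑ b ∈ (basisAttack r).messages,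
        (((basisAttack r).povm U b *
          (basisAttack r).channel ((haarEncryption 2 r).cipher U b)).trace).re =
      1 / 2 + (1 / (4 * r)) *
        ∑ i, |halfDiff r ((U : Matrix (Fin (r * 2)) (Fin (r * 2)) ℂ) i)| := by
    intro U
    have htr : ∀ b, ((guessPOVM r U b *
        basisMeasurement (Fin (r * 2)) ((haarEncryption 2 r).cipher U b)).trace).re =
        ∑ i ∈ guessSet r U b, ((haarEncryption 2 r).cipher U b i i).re := by
      intro b
      rw [guessPOVM, Finset.sum_mul, trace_sum, Complex.re_sum]
      refine Finset.sum_congr rfl fun i _ => ?_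
      rw [Matrix.trace_single_mul, basisMeasurement_eq_diagonal]
      simp
    change (1 / (((Finset.univ : Finset (Fin 2)).card : ℕ) : ℝ)) * ∑ b : Fin 2,
      ((guessPOVM r U b *
        basisMeasurement (Fin (r * 2)) ((haarEncryption 2 r).cipher U b)).trace).re = _
    simp only [htr, Fin.sum_univ_two]
    have hG1 : guessSet r U 1 = (guessSet r U 0)ᶜ := by simp [guessSet]
    have hG : ∀ i, i ∈ guessSet r U 0 ↔
        0 ≤ halfDiff r ((U : Matrix (Fin (r * 2)) (Fin (r * 2)) ℂ) i) := by
      intro i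
      have hr' : (0 : ℝ) < 2 * r := by positivity
      simp only [guessSet, if_true, Finset.mem_filter, Finset.mem_univ, true_and, ge_iff_le]
      rw [cipher_diag_re, cipher_diag_re, div_le_div_iff_of_pos_right hr']
      simp only [if_true, one_ne_zero, if_false]
      constructor <;> intro h <;> linarith
    have hsum : ∑ i ∈ guessSet r U 0, ((haarEncryption 2 r).cipher U 0 i i).re +
        ∑ i ∈ guessSet r U 1, ((haarEncryption 2 r).cipher U 1 i i).re =
        ∑ i : Fin (r * 2),
          (1 + |halfDiff r ((U : Matrix (Fin (r * 2)) (Fin (r * 2)) ℂ) i)|) / (2 * r) := by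
      rw [← Finset.sum_add_sum_compl (guessSet r U 0), hG1]
      congr 1
      · refine Finset.sum_congr rfl fun i hi => ?_
        rw [cipher_diag_re, abs_of_nonneg ((hG i).mp hi)]
        simp
      · refine Finset.sum_congr rfl fun i hi => ?_
        rw [Finset.mem_compl, hG, not_le] at hi
        rw [cipher_diag_re, abs_of_neg hi]
        simp
    rw [hsum, ← Finset.sum_div, Finset.sum_add_distrib]
    simp only [Finset.card_univ, Fintype.card_fin, Finset.sum_const, nsmul_eq_mul]
    push_cast
    field_simp
    ring
  have hI : ∀ i ∈ (Finset.univ : Finset (Fin (r * 2))), Integrable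
      (fun U : unitaryGroup (Fin (r * 2)) ℂ =>
        |halfDiff r ((U : Matrix (Fin (r * 2)) (Fin (r * 2)) ℂ) i)|) (haarUnitary (r * 2)) := by
    intro i _
    simpa using integrable_abs_halfDiff r 1 i
  rw [winProb]
  simp only [hint]
  change ∫ U, _ ∂(haarUnitary (r * 2)) = _
  rw [integral_add (integrable_const _) ((integrable_finsetSum _ hI).const_mul _), integral_const,
    integral_const_mul, integral_finsetSum _ hI]
  simp only [integral_abs_halfDiff, Finset.sum_const, Finset.card_univ, Fintype.card_fin,
    nsmul_eq_mul, probReal_univ, one_smul]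
  push_cast
  field_simp
  ring

/-! ### Optimality of the computational-basis attack -/

/-- Spectral theorem: measuring `P` amounts to weighted basis tests after a fixed rotation, which
the key absorbs by left multiplication. -/
theorem exists_unitary_trace_mul_cipher (r : ℕ) [NeZero r]
    {P : Matrix (Fin (r * 2)) (Fin (r * 2)) ℂ} (hP : P.PosSemidef) :
    ∃ (V : unitaryGroup (Fin (r * 2)) ℂ) (l : Fin (r * 2) → ℝ), (∀ k, 0 ≤ l k) ∧
      ((∑ k, l k : ℝ) : ℂ) = P.trace ∧ ∀ U b, ((P * (haarEncryption 2 r).cipher U b).trace).re =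
        ∑ k, l k * ((haarEncryption 2 r).cipher (V * U) b k k).re := by
  refine ⟨hP.1.eigenvectorUnitary⁻¹, hP.1.eigenvalues, hP.eigenvalues_nonneg, ?_, fun U b => ?_⟩
  · rw [hP.1.trace_eq_sum_eigenvalues]
    simp
  · set V := hP.1.eigenvectorUnitary with hV
    have hs : P = (V : Matrix (Fin (r * 2)) (Fin (r * 2)) ℂ) *
        diagonal (RCLike.ofReal ∘ hP.1.eigenvalues) *
        (V : Matrix (Fin (r * 2)) (Fin (r * 2)) ℂ)ᴴ := by
      have h := hP.1.spectral_theorem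
      rw [Unitary.conjStarAlgAut_apply] at h
      exact h
    have hc : (haarEncryption 2 r).cipher (V⁻¹ * U) b =
        (V : Matrix (Fin (r * 2)) (Fin (r * 2)) ℂ)ᴴ * (haarEncryption 2 r).cipher U b *
          (V : Matrix (Fin (r * 2)) (Fin (r * 2)) ℂ) := by
      change ((V : Matrix (Fin (r * 2)) (Fin (r * 2)) ℂ)ᴴ *
        (U : Matrix (Fin (r * 2)) (Fin (r * 2)) ℂ)) * blockState 2 r b *
        ((V : Matrix (Fin (r * 2)) (Fin (r * 2)) ℂ)ᴴ *
        (U : Matrix (Fin (r * 2)) (Fin (r * 2)) ℂ))ᴴ =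
        (V : Matrix (Fin (r * 2)) (Fin (r * 2)) ℂ)ᴴ *
        ((U : Matrix (Fin (r * 2)) (Fin (r * 2)) ℂ) * blockState 2 r b *
        (U : Matrix (Fin (r * 2)) (Fin (r * 2)) ℂ)ᴴ) *
        (V : Matrix (Fin (r * 2)) (Fin (r * 2)) ℂ)
      simp only [conjTranspose_mul, conjTranspose_conjTranspose, Matrix.mul_assoc]
    have ht : (P * (haarEncryption 2 r).cipher U b).trace =
        (diagonal (RCLike.ofReal ∘ hP.1.eigenvalues) *
          (haarEncryption 2 r).cipher (V⁻¹ * U) b).trace := by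
      conv_lhs => rw [hs]
      rw [hc, Matrix.mul_assoc, Matrix.mul_assoc, trace_mul_comm]
      simp only [Matrix.mul_assoc]
    rw [ht, trace, Complex.re_sum]
    refine Finset.sum_congr rfl fun k _ => ?_
    simp [diag_apply, diagonal_mul]

theorem abs_halfDiff_row_le_one (r : ℕ) (U : unitaryGroup (Fin (r * 2)) ℂ) (i : Fin (r * 2)) :
    |halfDiff r ((U : Matrix (Fin (r * 2)) (Fin (r * 2)) ℂ) i)| ≤ 1 := by
  exact (abs_halfDiff_le r _).trans (sum_sq_norm_row_unitary U i).le

/-- For each key, outcome and eigenvector, the receiver's choice yields a convex combination of `1 +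
h` and `1 - h`, at most `1 + |h|`. The mean of `|h|` is the same for every eigenvector, so only the
total weight `2r` matters. -/
theorem winProb_le_of_isMeasurementChannel (r : ℕ) [NeZero r] {B : Type*} [Fintype B]
    [DecidableEq B]
    (A : Attack (Fin 2) (unitaryGroup (Fin (r * 2)) ℂ) (Fin (r * 2)) B)
    (hcard : A.messages.card = 2) (hA : IsMeasurementChannel A.channel) :
    winProb (haarEncryption 2 r) A ≤ 1 / 2 + 1 / 2 * (((2 * r).choose r : ℝ) / 4 ^ r) := by
  have hr : (0 : ℝ) < r := by exact_mod_cast Nat.pos_of_ne_zero (NeZero.ne r)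
  have hm : A.messages = Finset.univ := Finset.eq_univ_of_card _ (by simpa using hcard)
  obtain ⟨P, hP, hΦ⟩ := hA
  choose V l hl hlt htr using fun x =>
    exists_unitary_trace_mul_cipher r (hP.posSemidef x (Finset.mem_univ x))
  have hltot : ∑ x, ∑ k, l x k = 2 * r := by
    have h : ((∑ x, ∑ k, l x k : ℝ) : ℂ) = ((2 * r : ℝ) : ℂ) := by
      rw [Complex.ofReal_sum]
      simp only [hlt]
      rw [← trace_sum, hP.sum_eq_one, trace_one]
      simp [mul_comm]
    exact_mod_cast h
  set h : B → Fin (r * 2) → unitaryGroup (Fin (r * 2)) ℂ → ℝ := fun x k U =>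
    halfDiff r (((V x * U : unitaryGroup (Fin (r * 2)) ℂ) :
      Matrix (Fin (r * 2)) (Fin (r * 2)) ℂ) k) with hh
  have h1 : ∀ x k U, |h x k U| ≤ 1 := fun x k U => abs_halfDiff_row_le_one r _ _
  have hpt : ∀ U : unitaryGroup (Fin (r * 2)) ℂ, ∃ q : Fin 2 → B → ℝ, (∀ b x, 0 ≤ q b x) ∧
      (∀ x, q 0 x + q 1 x = 1) ∧
      (1 / (A.messages.card : ℝ)) * ∑ b ∈ A.messages,
        ((A.povm U b * A.channel ((haarEncryption 2 r).cipher U b)).trace).re =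
      ∑ x, ∑ k, l x k / (4 * r) * (q 0 x * (1 + h x k U) + q 1 x * (1 - h x k U)) := by
    intro U
    have hpov := A.isPOVM U
    rw [hm] at hpov
    have hnn : ∀ b x, 0 ≤ A.povm U b x x := fun b x =>
      (hpov.posSemidef b (Finset.mem_univ b)).diag_nonneg
    -- The channel output is diagonal, so only the diagonal of the receiver's POVM counts: a
    -- randomised guess given `x`.
    refine ⟨fun b x => (A.povm U b x x).re, fun b x => (Complex.le_def.mp (hnn b x)).1,
      fun x => ?_, ?_⟩
    · have := congrFun (congrFun hpov.sum_eq_one x) x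
      rw [Fin.sum_univ_two, Matrix.add_apply, one_apply_eq] at this
      rw [← Complex.add_re, this, Complex.one_re]
    · have htrace : ∀ b, ((A.povm U b * A.channel ((haarEncryption 2 r).cipher U b)).trace).re =
          ∑ x, (A.povm U b x x).re * ∑ k, l x k *
            ((1 + (if b = 0 then 1 else -1) * h x k U) / (2 * r)) := by
        intro b
        rw [hΦ, Finset.mul_sum, trace_sum, Complex.re_sum]
        refine Finset.sum_congr rfl fun x _ => ?_
        have him : (A.povm U b x x).im = 0 := (Complex.le_def.mp (hnn b x)).2.symm
        rw [Matrix.mul_smul, trace_smul, trace_mul_single, smul_eq_mul, MulOpposite.op_one, one_smul]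
        simp only [Complex.mul_re, him, mul_zero, sub_zero, htr, cipher_diag_re]
        rw [mul_comm]
      rw [hm, Fin.sum_univ_two, htrace, htrace, ← Finset.sum_add_distrib, Finset.mul_sum]
      refine Finset.sum_congr rfl fun x _ => ?_
      rw [Finset.mul_sum, Finset.mul_sum, ← Finset.sum_add_distrib, Finset.mul_sum]
      refine Finset.sum_congr rfl fun k _ => ?_
      simp only [Finset.card_univ, Fintype.card_fin, if_true, one_ne_zero, if_false]
      push_cast
      field_simp
      ring
  have hi : ∀ x k, Integrable (fun U => |h x k U|) (haarUnitary (r * 2)) := fun x k =>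
    integrable_abs_halfDiff r (V x) k
  have hint : ∀ x k, Integrable (fun U => l x k / (4 * r) * (1 + |h x k U|))
      (haarUnitary (r * 2)) := fun x k =>
    ((integrable_const 1).add (hi x k)).const_mul _
  have hval : ∀ x k, ∫ U, |h x k U| ∂(haarUnitary (r * 2)) = ((2 * r).choose r : ℝ) / 4 ^ r := by
    intro x k
    rw [← integral_abs_halfDiff r k]
    exact integral_mul_left_eq_self (μ := haarUnitary (r * 2))
      (fun U : unitaryGroup (Fin (r * 2)) ℂ =>
        |halfDiff r ((U : Matrix (Fin (r * 2)) (Fin (r * 2)) ℂ) k)|) (V x)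
  have hle : winProb (haarEncryption 2 r) A ≤
      ∫ U, ∑ x, ∑ k, l x k / (4 * r) * (1 + |h x k U|) ∂(haarUnitary (r * 2)) := by
    -- With a nonnegative integrand on the left, only the upper bound has to be integrable.
    refine integral_mono_of_nonneg (Filter.Eventually.of_forall fun U => ?_)
      (integrable_finsetSum _ fun x _ => integrable_finsetSum _ fun k _ => hint x k)
      (Filter.Eventually.of_forall fun U => ?_)
    · obtain ⟨q, hq0, -, hq⟩ := hpt U
      simp only [Pi.zero_apply]
      rw [hq]
      refine Finset.sum_nonneg fun x _ => Finset.sum_nonneg fun k _ => ?_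
      have hb := abs_le.mp (h1 x k U)
      have h2 : 0 ≤ 1 + h x k U := by linarith
      have h3 : 0 ≤ 1 - h x k U := by linarith
      have := hq0 0 x
      have := hq0 1 x
      have := hl x k
      positivity
    · obtain ⟨q, hq0, hq1, hq⟩ := hpt U
      simp only
      rw [hq]
      refine Finset.sum_le_sum fun x _ => Finset.sum_le_sum fun k _ => ?_
      have := hl x k
      refine mul_le_mul_of_nonneg_left ?_ (by positivity)
      have e0 := mul_le_mul_of_nonneg_left (le_abs_self (h x k U)) (hq0 0 x)
      have e1 := mul_le_mul_of_nonneg_left (neg_le_abs (h x k U)) (hq0 1 x)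
      have e2 : q 1 x = 1 - q 0 x := by linarith [hq1 x]
      rw [e2] at e1 ⊢
      nlinarith
  refine hle.trans (le_of_eq ?_)
  rw [integral_finsetSum _ fun x _ => integrable_finsetSum _ fun k _ => hint x k]
  have hinner : ∀ x, ∫ U, ∑ k, l x k / (4 * r) * (1 + |h x k U|) ∂(haarUnitary (r * 2)) =
      (∑ k, l x k) * ((1 + ((2 * r).choose r : ℝ) / 4 ^ r) / (4 * r)) := by
    intro x
    rw [integral_finsetSum _ fun k _ => hint x k, Finset.sum_mul]
    refine Finset.sum_congr rfl fun k _ => ?_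
    rw [integral_const_mul, integral_add (integrable_const _) (hi x k), hval, integral_const]
    simp only [probReal_univ, one_smul]
    ring
  simp only [hinner]
  rw [← Finset.sum_mul, hltot]
  field_simp
  ring

theorem telegraphingValue_haarEncryption (r : ℕ) [NeZero r] :
    telegraphingValue 2 (haarEncryption 2 r) =
      1 / 2 + 1 / 2 * (((2 * r).choose r : ℝ) / 4 ^ r) := by
  refine IsGreatest.csSup_eq ⟨⟨Fin (r * 2), inferInstance, inferInstance, basisAttack r, by
    simp [basisAttack], basisMeasurement_isMeasurementChannel _, (winProb_basisAttack r).symm⟩, ?_⟩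
  rintro p ⟨B, hB, hB', A, hcard, hA, rfl⟩
  exact winProb_le_of_isMeasurementChannel r A hcard hA

theorem mainTheorem6 :
    -- the attack is a telegraphing attack, and its exact winning probability, with `d = 2r`
    (∀ (r : ℕ) [NeZero r],
      IsMeasurementChannel (basisAttack r).channel ∧
      winProb (haarEncryption 2 r) (basisAttack r) =
        1 / 2 + 1 / 2 ^ (2 * r + 1) * ((2 * r).choose r : ℝ)) ∧
    -- its asymptotics `1/2 + 1/√(2πd) + O(d^{-3/2})`
    (∃ C : ℝ, ∀ (r : ℕ) [NeZero r],
      |winProb (haarEncryption 2 r) (basisAttack r) -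
          (1 / 2 + 1 / Real.sqrt (2 * Real.pi * (2 * r : ℝ)))| ≤
        C / (2 * r : ℝ) ^ (3 / 2 : ℝ)) ∧
    -- the one-copy upper bound on the telegraphing-distinguishing value ...
    (∀ (r : ℕ) [NeZero r],
      winProb (haarEncryption 2 r) (basisAttack r) ≤ telegraphingValue 2 (haarEncryption 2 r) ∧
      telegraphingValue 2 (haarEncryption 2 r) ≤
        1 / 2 + 1 / (2 * Real.sqrt ((2 * r : ℝ) + 1))) ∧
    -- ... is tight in order
    (∃ c : ℝ, 0 < c ∧ ∀ (r : ℕ) [NeZero r],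
      1 / 2 + c * (1 / (2 * Real.sqrt ((2 * r : ℝ) + 1))) ≤
        telegraphingValue 2 (haarEncryption 2 r)) := by
  -- Both constants leave room: `√2` would already do for `4`, and `c = 1/2` requires only `π ≤ 8`.
  refine ⟨fun r _ => ⟨basisMeasurement_isMeasurementChannel _, ?_⟩, ⟨4, fun r _ => ?_⟩,
    fun r _ => ⟨?_, ?_⟩, ⟨1 / 2, by norm_num, fun r _ => ?_⟩⟩
  · rw [winProb_basisAttack, pow_succ, pow_mul, show (2 : ℝ) ^ 2 = 4 by norm_num]
    field_simp
  · have hr : 0 < r := Nat.pos_of_ne_zero (NeZero.ne r)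
    have hr' : (0 : ℝ) < r := by exact_mod_cast hr
    have h := abs_choose_div_four_pow_sub_le r hr
    have hs : Real.sqrt (2 * Real.pi * (2 * r)) = 2 * Real.sqrt (Real.pi * r) := by
      rw [show 2 * Real.pi * (2 * (r : ℝ)) = 2 ^ 2 * (Real.pi * r) by ring,
        Real.sqrt_mul (by positivity), Real.sqrt_sq (by norm_num)]
    have hpow : (2 * r : ℝ) ^ (3 / 2 : ℝ) = 2 * r * (Real.sqrt 2 * Real.sqrt r) := by
      rw [show (3 / 2 : ℝ) = 1 + 1 / 2 by norm_num, Real.rpow_add (by positivity), Real.rpow_one,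
        ← Real.sqrt_eq_rpow, Real.sqrt_mul (by norm_num)]
    have hsr : 0 < Real.sqrt r := Real.sqrt_pos.mpr hr'
    have hs2 : Real.sqrt 2 ≤ 2 := by
      rw [Real.sqrt_le_left (by norm_num)]
      norm_num
    have hs2' : 0 < Real.sqrt 2 := Real.sqrt_pos.mpr (by norm_num)
    rw [winProb_basisAttack, hs, hpow]
    have e : 1 / 2 + 1 / 2 * (((2 * r).choose r : ℝ) / 4 ^ r) -
        (1 / 2 + 1 / (2 * Real.sqrt (Real.pi * r))) =
        1 / 2 * (((2 * r).choose r : ℝ) / 4 ^ r - 1 / Real.sqrt (Real.pi * r)) := by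
      rw [← one_div_mul_one_div]
      ring
    rw [e, abs_mul, abs_of_pos (by norm_num : (0 : ℝ) < 1 / 2)]
    have h3 : 1 / (r * Real.sqrt r) ≤ 4 / (2 * r * (Real.sqrt 2 * Real.sqrt r)) := by
      rw [div_le_div_iff₀ (by positivity) (by positivity)]
      have : 0 < r * Real.sqrt r := by positivity
      nlinarith
    have h4 : 0 ≤ 1 / (r * Real.sqrt r) := by positivity
    linarith
  · rw [telegraphingValue_haarEncryption, winProb_basisAttack]
  · have hr : 0 < r := Nat.pos_of_ne_zero (NeZero.ne r)
    have hr' : (1 : ℝ) ≤ r := by exact_mod_cast hr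
    have hpi := Real.pi_gt_three
    rw [telegraphingValue_haarEncryption]
    have h : ((2 * r).choose r : ℝ) / 4 ^ r ≤ 1 / Real.sqrt (2 * r + 1) := by
      refine (sq_le_sq₀ (by positivity) (by positivity)).mp
        ((choose_div_four_pow_sq_le r hr).trans ?_)
      rw [div_pow, one_pow, Real.sq_sqrt (by positivity)]
      -- `2r + 1 ≤ 3r ≤ π r` since `r ≥ 1`.
      exact one_div_le_one_div_of_le (by positivity) (by nlinarith)
    rw [← one_div_mul_one_div]
    linarith
  · have hpi := Real.pi_lt_four
    rw [telegraphingValue_haarEncryption]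
    have h : 1 / 2 * (1 / Real.sqrt (2 * r + 1)) ≤ ((2 * r).choose r : ℝ) / 4 ^ r := by
      refine (sq_le_sq₀ (by positivity) (by positivity)).mp
        (le_trans ?_ (choose_div_four_pow_sq_ge r))
      rw [mul_pow, div_pow, div_pow, one_pow, Real.sq_sqrt (by positivity), div_mul_div_comm,
        div_le_div_iff₀ (by positivity) (by positivity)]
      have : 0 < 2 * (r : ℝ) + 1 := by positivity
      nlinarith [Real.pi_pos]
    rw [← one_div_mul_one_div]
    linarith
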